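/- **Setting.** There are $M$ players; player $p\in[M]$ faces an episodic Markov decision process with episode length $H$, a common finite state space $\mathcal S$, a common finite action space $\mathcal A$ and a common initial distribution $p_0$. The states are partitioned into layers $\mathcal S_1,\dots,\mathcal S_H$, $p_0$ is supported on $\mathcal S_1$, and $\mathcal S_{H+1}=\{\bot\}$ with $\bot\notin\mathcal S$ a terminal state. Player $p$ has transition probabilities $\mathbb P_p(\cdot\mid s,a)$, supported on $\mathcal S_{h+1}$ for $s\in\mathcal S_h$, and reward distributions $r_p(s,a)$ on $[0,1]$ with means $R_p(s,a)$. For $\epsilon\ge 0$ this is an *$\epsilon$-MPERL problem instance* if $|R_p(s,a)-R_q(s,a)|\le\epsilon$ and $\|\mathbb P_p(\cdot\mid s,a)-\mathbb P_q(\cdot\mid s,a)\|_1\le\epsilon/H$ for all $p,q,s,a$. The optimal values are given by $V_p^\star(\bot)=0$, $Q_p^\star(s,a)=R_p(s,a)+\sum_{s'}\mathbb P_p(s'\mid s,a)V_p^\star(s')$ and $V_p^\star(s)=\max_a Q_p^\star(s,a)$; the value $V^\pi_p$ of a policy $\pi:\mathcal S\to\mathcal A$ is given by the same recursion with $a=\pi(s)$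 in place of the maximum; and $V^\star_{0,p}=\mathbb E_{s\sim p_0}V^\star_p(s)$, $V^\pi_{0,p}=\mathbb E_{s\sim p_0}V^\pi_p(s)$. Put $$\mathrm{gap}_p(s,a)=V_p^\star(s)-Q_p^\star(s,a),\qquad \mathcal I_\eta=\{(s,a):\exists p\in[M],\ \mathrm{gap}_p(s,a)>96H\eta\}.$$ In each episode $k$ a (possibly randomized) algorithm chooses, from the number $K$ of episodes and the history of all players in the previous episodes, a policy $\pi^k(p)$ for every player $p$; the players then independently run one episode each. Its expected collective regret is $\mathbb E[\mathrm{Reg}_{\mathrm{Alg}}(K)]=\mathbb E\sum_{p=1}^M\sum_{k=1}^K\bigl(V^\star_{0,p}-V^{\pi^k(p)}_{0,p}\bigr)$. The algorithm is a *sublinear regret algorithm for the $\epsilon$-MPERL problem*, with constant $C>0$ and exponent $\alpha<1$, if $\mathbb E[\mathrm{Reg}_{\mathrm{Alg}}(K)]\le CK^\alpha$ for all $K\ge1$ and all $\epsilon$-MPERL problem instances with the given number of players, layered state space, actions and initial distribution. **Theorem (gap-dependent lower bound).** There is an absolute constant $c>0$ with the following property. Let $\epsilon\ge0$, $A\ge2$,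 $H\ge2$, $M\in\mathbb N$, $S>2(H-1)$ and $S_1=S-2(H-1)$, and let $(\Delta_{s,a,p})_{(s,a,p)\in[S_1]\times[A]\times[M]}$ be real numbers such that (1) $\Delta_{s,a,p}\in[0,H/(48\sqrt M)]$ for all $s,a,p$; (2) for every $(s,p)$ there is an action $a$ with $\Delta_{s,a,p}=0$; (3) $|\Delta_{s,a,p}-\Delta_{s,a,q}|\le\epsilon/4$ for all $s,a,p,q$. Then there is an $\epsilon$-MPERL problem instance with $S$ states, $A$ actions, $M$ players and episode length $H$ such that $\mathcal S_1=[S_1]$, $|\mathcal S_h|=2$ for all $2\le h\le H$, and $\mathrm{gap}_p(s,a)=\Delta_{s,a,p}$ for all $(s,a,p)\in[S_1]\times[A]\times[M]$, and such that, on this instance, every sublinear regret algorithm for the $\epsilon$-MPERL problem, with constant $C$ and exponent $\alpha$, satisfies for all sufficiently large $K$ $$\mathbb E[\mathrm{Reg}_{\mathrm{Alg}}(K)]\ \ge\ c\,(1-\alpha)\,\ln K\left(\sum_{p\in[M]}\ \sum_{\substack{(s,a)\notin\mathcal I_{\epsilon/(768H)}\\ \mathrm{gap}_p(s,a)>0}}\frac{H^2}{\mathrm{gap}_p(s,a)}\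 +\sum_{\substack{(s,a)\in\mathcal I_{\epsilon/(768H)}\\ \min_p\mathrm{gap}_p(s,a)>0}}\frac{H^2}{\min_p\mathrm{gap}_p(s,a)}\right).$$ -/

import Mathlib

open MeasureTheory ProbabilityTheory Filter
open scoped unitInterval

set_option synthInstance.maxSize 1000

noncomputable section

namespace MPERL

/-- The data shared by all players: `S` states partitioned into layers `1, …, H`
(`layer s = h` means that `s` belongs to the `h`-th layer), and an initial state
distribution supported on the first layer. -/
structure Setting (S H : ℕ) where
  layer : Fin S → ℕ
  one_le_layer : ∀ s, 1 ≤ layer s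
  layer_le : ∀ s, layer s ≤ H
  init : PMF (Fin S)
  layer_init : ∀ s ∈ init.support, layer s = 1

/-- The terminal state `⊥` is `none`; it forms the layer `H + 1`. -/
def Setting.stage {S H : ℕ} (G : Setting S H) : Option (Fin S) → ℕ
  | none => H + 1
  | some s => G.layer s

/-- A deterministic history-independent policy of one player. -/
abbrev Policy (S A : ℕ) := Fin S → Fin A

/-- One policy for each of the `M` players. -/
abbrev JointPolicy (S A M : ℕ) := Fin M → Policy S A

/-- The record of one step: the state, the action taken, and the reward received; `Sum.inr ()`
stands for a step at the terminal state, where nothing happens. -/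
abbrev Step (S A : ℕ) := (Fin S × Fin A × I) ⊕ Unit

/-- What is observed in one episode: the policies executed and the trajectories of the players. -/
abbrev Episode (S A H M : ℕ) := JointPolicy S A M × (Fin M → Fin H → Step S A)

/-- A collection of `M` layered MDPs with `A` actions over a common setting: transition
probabilities into `𝒮 ∪ {⊥}`, from each layer into the next one, and reward distributions
on `[0,1]`. -/
structure Environment {S H : ℕ} (G : Setting S H) (A M : ℕ) where
  trans : Fin M → Fin S → Fin A → PMF (Option (Fin S))
  layered : ∀ p s a, ∀ x ∈ (trans p s a).support, G.stage x = G.layer s + 1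
  reward : Fin M → Fin S → Fin A → ProbabilityMeasure I

namespace Environment

variable {S H A M : ℕ} {G : Setting S H} (E : Environment G A M)

/-- The expected immediate reward `R_p(s,a)`. -/
def meanReward (p : Fin M) (s : Fin S) (a : Fin A) : ℝ :=
  ∫ x : I, (x : ℝ) ∂(E.reward p s a : Measure I)

/-- `(ℙ_p f)(s,a)`. -/
def expectNext (p : Fin M) (f : Option (Fin S) → ℝ) (s : Fin S) (a : Fin A) : ℝ :=
  ∑ x, (E.trans p s a x).toReal * f x

/-- The optimal expected reward of player `p` over the next `n` steps. -/
def optValueAux (p : Fin M) : ℕ → Option (Fin S) → ℝ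
  | 0, _ => 0
  | _ + 1, none => 0
  | n + 1, some s => ⨆ a, (E.meanReward p s a + E.expectNext p (optValueAux p n) s a)

/-- The collated optimal value function `V_p^⋆`, with `V_p^⋆(⊥) = 0`. -/
def optValue (p : Fin M) (x : Option (Fin S)) : ℝ :=
  E.optValueAux p (H + 1 - G.stage x) x

/-- The optimal action-value function `Q_p^⋆`. -/
def optQ (p : Fin M) (s : Fin S) (a : Fin A) : ℝ :=
  E.meanReward p s a + E.expectNext p (E.optValue p) s a

/-- The suboptimality gap `gap_p(s,a) = V_p^⋆(s) - Q_p^⋆(s,a)`. -/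
def gap (p : Fin M) (s : Fin S) (a : Fin A) : ℝ :=
  E.optValue p (some s) - E.optQ p s a

/-- The expected reward of player `p` over the next `n` steps under the policy `π`. -/
def valueAux (p : Fin M) (π : Policy S A) : ℕ → Option (Fin S) → ℝ
  | 0, _ => 0
  | _ + 1, none => 0
  | n + 1, some s => E.meanReward p s (π s) + E.expectNext p (valueAux p π n) s (π s)

/-- The collated value function `V_p^π`. -/
def value (p : Fin M) (π : Policy S A) (x : Option (Fin S)) : ℝ :=
  E.valueAux p π (H + 1 - G.stage x) x

/-- `V_{0,p}^⋆`. -/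
def optValue₀ (p : Fin M) : ℝ :=
  ∑ s, (G.init s).toReal * E.optValue p (some s)

/-- `V_{0,p}^π`. -/
def value₀ (p : Fin M) (π : Policy S A) : ℝ :=
  ∑ s, (G.init s).toReal * E.value p π (some s)

/-- `ε`-dissimilarity: the environment is an `ε`-MPERL problem instance. -/
def IsDissimilar (ε : ℝ) : Prop :=
  ∀ (p q : Fin M) (s : Fin S) (a : Fin A),
    |E.meanReward p s a - E.meanReward q s a| ≤ ε ∧
    ∑ x, |(E.trans p s a x).toReal - (E.trans q s a x).toReal| ≤ ε / H

/-- The set of subpar state-action pairs. -/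
def subpar (η : ℝ) : Set (Fin S × Fin A) :=
  {x | ∃ p, 96 * H * η < E.gap p x.1 x.2}

/-- The law of the records of the next `n` steps of player `p` who starts at the given state and
executes `π`. -/
def rollout (p : Fin M) (π : Policy S A) :
    (n : ℕ) → Option (Fin S) → Measure (Fin n → Step S A)
  | 0, _ => Measure.dirac Fin.elim0
  | _ + 1, none => Measure.dirac (fun _ => Sum.inr ())
  | n + 1, some s =>
      ((E.reward p s (π s) : Measure I).prod
        (∑ x, E.trans p s (π s) x • rollout p π n x)).map
        (fun y => (Fin.cons (Sum.inl (s, π s, y.1)) y.2 : Fin (n + 1) → Step S A))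

/-- The law of one episode of player `p` who executes `π`. -/
def trajLaw (p : Fin M) (π : Policy S A) : Measure (Fin H → Step S A) :=
  ∑ s, G.init s • E.rollout p π H (some s)

/-- The law of one episode of all players, who act independently of each other. -/
def episodeKernel : Kernel (JointPolicy S A M) (Fin M → Fin H → Step S A) :=
  Kernel.ofFunOfCountable (fun π => Measure.pi (fun p => E.trajLaw p (π p)))

end Environment

/-- A (possibly randomized) algorithm: given the number `K` of episodes to be played and the
history of the first `k` episodes of all players, it chooses the joint policy of the next episode.
Algorithms that do not use `K`, and deterministic ones, are special cases. -/
structure Algorithm (S A H M : ℕ) where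
  next : (K k : ℕ) → Kernel (Fin k → Episode S A H M) (JointPolicy S A M)
  isMarkov : ∀ K k, IsMarkovKernel (next K k)

namespace Algorithm

variable {S A H M : ℕ} (alg : Algorithm S A H M) {G : Setting S H}

/-- The law of the history of the first `k` episodes (out of `K`) when the algorithm is run on
`E`. -/
def historyLaw (E : Environment G A M) (K : ℕ) : (k : ℕ) → Measure (Fin k → Episode S A H M)
  | 0 => Measure.dirac Fin.elim0
  | k + 1 =>
      ((historyLaw E K k).compProd
        ((alg.next K k).compProd (Kernel.prodMkLeft _ E.episodeKernel))).map
        (fun y => (Fin.snoc y.1 y.2 : Fin (k + 1) → Episode S A H M))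

/-- The expected collective regret over `K` episodes. -/
def expectedRegret (E : Environment G A M) (K : ℕ) : ℝ :=
  ∫ h, ∑ p, ∑ k, (E.optValue₀ p - E.value₀ p ((h k).1 p)) ∂(alg.historyLaw E K K)

/-- The algorithm is a sublinear regret algorithm for the `ε`-MPERL problem over `G`, with
constant `C > 0` and exponent `α < 1`. -/
def IsSublinear (G : Setting S H) (ε C α : ℝ) : Prop :=
  0 < C ∧ α < 1 ∧ ∀ E : Environment G A M, E.IsDissimilar ε →
    ∀ K : ℕ, 1 ≤ K → alg.expectedRegret E K ≤ C * (K : ℝ) ^ α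

end Algorithm

open Classical in
/-- The sum of `H² / gap_p(s,a)` over the players `p` and the pairs `(s,a)` that are not subpar at
level `η` and have `gap_p(s,a) > 0`, plus the sum of `H² / min_p gap_p(s,a)` over the pairs
`(s,a)` that are subpar at level `η` and have `min_p gap_p(s,a) > 0`. -/
def gapComplexity {S H A M : ℕ} {G : Setting S H} (E : Environment G A M) (η : ℝ) : ℝ :=
  (∑ p : Fin M, ∑ x : Fin S × Fin A with x ∉ E.subpar η ∧ 0 < E.gap p x.1 x.2,
    (H : ℝ) ^ 2 / E.gap p x.1 x.2) +
  ∑ x : Fin S × Fin A with x ∈ E.subpar η ∧ ∀ p, 0 < E.gap p x.1 x.2,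
    (H : ℝ) ^ 2 / ⨅ p, E.gap p x.1 x.2

end MPERL

end

/-!
The hard instance is a tower of two-state layers. From a state `s` of the first layer, the action
`a` of player `p` leads with probability `1 / 2 - Δ / (H - 1)` to a good state of the second layer,
where `Δ` is the prescribed gap of `(s, a, p)`, and to a bad one otherwise. Whatever is done
afterwards, the good state yields reward `1` in each of the `H - 1` remaining steps and the bad one
yields `0`. So the gap of `(s, a)` is `Δ` in the first layer and `0` beyond it, and the regret of an
episode is the expected gap at its initial state (`optValue₀_sub_value₀`).

For the lower bound, the instance is compared with alternatives in which a given pair `(s, a)` is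
optimal for some player `p`, being better than all other actions by `δ`. An algorithm of sublinear
regret lets `p` execute `a` in `s` in a minority of the episodes on the original instance and in a
majority on the alternative, up to probability `O(K ^ (α - 1))`. By the Bretagnolle–Huber inequality
(`exp_integral_sub_one_le`), the relative entropy of the two laws of the history is therefore at
least `(1 - α) log K - O(1)` (`Algorithm.eventually_log_le_integral_kl`). On the other hand, it is
the expected sum of the divergences of the episodes (`Algorithm.integral_historyLogLik`), which is
at most `80 δ² / H²` times the expected number of episodes in which an affected player starts in `s`
and executes `a` there (`klEpisode_advantageTower_le`). Such an episode costs a regret of at least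
`δ`, so that the total cost of the pair is at least of order `(1 - α) log K * H² / δ`.

Which alternatives are `ε`-dissimilar decides between the two sums of the gap complexity. If all
players have gap at most `ε / 8` at `(s, a)`, which is what it means not to be subpar at level
`ε / (768 H)`, then the advantage can be raised from `-Δ` to `Δ` for one player alone, and each
player pays separately (`eventually_le_pairRegret`). Otherwise it is raised by twice the smallest
gap for all players at once, which keeps their differences; then the players share the cost
(`eventually_le_sum_pairRegret`).

The law of a history under the alternative is obtained from the original one by an explicit density.
Since only the transitions out of the first layer are changed, the log-likelihood ratio of a
trajectory depends on its first transition alone, and the trajectory laws of both instances are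
mixtures of the same components (`Comparable.trajLaw_eq_withDensity`).
-/

noncomputable section

/-! ### Densities of finite mixtures and of product measures -/

theorem withDensity_finsetSum {ι α : Type*} [MeasurableSpace α] (s : Finset ι) (μ : ι → Measure α)
    (f : α → ENNReal) :
    (∑ i ∈ s, μ i).withDensity f = ∑ i ∈ s, (μ i).withDensity f := by
  classical
  induction s using Finset.induction_on with
  | empty => simp
  | insert a s ha ih => simp [Finset.sum_insert ha, withDensity_add_measure, ih]

/-- Fubini for densities: a product of measures with densities has the product density. -/
theorem pi_withDensity_prod {ι : Type*} [Fintype ι] {X : ι → Type*} [∀ i, MeasurableSpace (X i)]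
    (μ : ∀ i, Measure (X i)) [∀ i, IsProbabilityMeasure (μ i)] (f : ∀ i, X i → ENNReal)
    (hf : ∀ i, Measurable (f i)) [∀ i, IsProbabilityMeasure ((μ i).withDensity (f i))] :
    Measure.pi (fun i => (μ i).withDensity (f i)) =
      (Measure.pi μ).withDensity (fun x => ∏ i, f i (x i)) := by
  refine (Measure.pi_eq (μ := fun i => (μ i).withDensity (f i)) fun s hs => ?_)
  have hm : ∀ i, Measurable ((s i).indicator (f i)) := fun i => (hf i).indicator (hs i)
  rw [withDensity_apply _ (MeasurableSet.univ_pi hs),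
    ← lintegral_indicator (MeasurableSet.univ_pi hs)]
  have h1 : ∀ x : ∀ i, X i, (Set.univ.pi s).indicator (fun x => ∏ i, f i (x i)) x =
      ∏ i, (s i).indicator (f i) (x i) := by
    intro x
    by_cases hx : x ∈ Set.univ.pi s
    · rw [Set.indicator_of_mem hx]
      exact Finset.prod_congr rfl fun i _ =>
        (Set.indicator_of_mem (hx i (Set.mem_univ i)) _).symm
    · rw [Set.indicator_of_notMem hx]
      simp only [Set.mem_pi, Set.mem_univ, true_imp_iff, not_forall] at hx
      obtain ⟨i, hi⟩ := hx
      exact (Finset.prod_eq_zero (Finset.mem_univ i) (Set.indicator_of_notMem hi _)).symm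
  simp_rw [h1]
  have hind : iIndepFun (fun i (x : ∀ i, X i) => (s i).indicator (f i) (x i)) (Measure.pi μ) :=
    iIndepFun_pi fun i => (hm i).aemeasurable
  have h2 := lintegral_prod_eq_prod_lintegral_of_indepFun Finset.univ _ hind
    (fun i => (hm i).comp (measurable_pi_apply i))
  refine h2.trans (Finset.prod_congr rfl fun i _ => ?_)
  rw [withDensity_apply _ (hs i), ← lintegral_indicator (hs i)]
  exact (measurePreserving_eval μ i).lintegral_comp (hm i)

/-! ### Decomposition of the trajectory law -/

namespace MPERL

/-- The state visited in a step. -/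
def Step.state {S A : ℕ} : Step S A → Option (Fin S) :=
  Sum.elim (fun y => some y.1) fun _ => none

/-- The state-action pair of a step. -/
def Step.pair {S A : ℕ} : Step S A → Option (Fin S × Fin A) :=
  Sum.elim (fun y => some (y.1, y.2.1)) fun _ => none

theorem Step.measurableSet_pair_eq {S A : ℕ} (o : Option (Fin S × Fin A)) :
    MeasurableSet {z : Step S A | z.pair = o} := by
  refine measurableSet_sum_iff.2 ⟨?_, ?_⟩
  · exact (measurable_fst.prodMk (measurable_fst.comp measurable_snd) :
      Measurable fun y : Fin S × Fin A × I => (y.1, y.2.1))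
      (Set.to_countable {y | some y = o}).measurableSet
  · exact (Set.to_countable _).measurableSet

theorem Step.measurableSet_state_eq {S A : ℕ} (o : Option (Fin S)) :
    MeasurableSet {z : Step S A | z.state = o} := by
  refine measurableSet_sum_iff.2 ⟨?_, ?_⟩
  · exact (measurable_fst : Measurable fun y : Fin S × Fin A × I => y.1)
      (Set.to_countable {y | some y = o}).measurableSet
  · exact (Set.to_countable _).measurableSet

namespace Environment

variable {S H A M : ℕ} {G : Setting S H}

theorem sum_trans (E : Environment G A M) (p : Fin M) (s : Fin S) (a : Fin A) :
    ∑ x, E.trans p s a x = 1 := by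
  rw [← tsum_fintype (L := .unconditional _)]; exact (E.trans p s a).tsum_coe

theorem sum_init (G : Setting S H) : ∑ s, G.init s = 1 := by
  rw [← tsum_fintype (L := .unconditional _)]; exact G.init.tsum_coe

theorem measurable_cons {n : ℕ} (s : Fin S) (a : Fin A) :
    Measurable (fun y : I × (Fin n → Step S A) =>
      (Fin.cons (Sum.inl (s, a, y.1)) y.2 : Fin (n + 1) → Step S A)) := by
  refine measurable_pi_iff.2 fun i => ?_
  refine Fin.cases ?_ (fun j => ?_) i
  · exact measurable_inl.comp (measurable_const.prodMk (measurable_const.prodMk measurable_fst))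
  · exact (measurable_pi_apply j).comp measurable_snd

theorem isProbabilityMeasure_sum_smul {ι α : Type*} [Fintype ι] [MeasurableSpace α]
    {c : ι → ENNReal} (hc : ∑ i, c i = 1) (μ : ι → Measure α)
    [∀ i, IsProbabilityMeasure (μ i)] : IsProbabilityMeasure (∑ i, c i • μ i) :=
  ⟨by simp [Measure.finsetSum_apply, hc]⟩

instance (E : Environment G A M) (p : Fin M) (π : Policy S A) (n : ℕ) (x : Option (Fin S)) :
    IsProbabilityMeasure (E.rollout p π n x) := by
  induction n generalizing x with
  | zero => unfold rollout; infer_instance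
  | succ n ih =>
    cases x with
    | none => unfold rollout; infer_instance
    | some s =>
      unfold rollout
      have := isProbabilityMeasure_sum_smul (E.sum_trans p s (π s)) (E.rollout p π n)
      exact Measure.isProbabilityMeasure_map (measurable_cons s (π s)).aemeasurable

instance (E : Environment G A M) (p : Fin M) (π : Policy S A) :
    IsProbabilityMeasure (E.trajLaw p π) :=
  isProbabilityMeasure_sum_smul (sum_init G) fun s => E.rollout p π H (some s)

instance (E : Environment G A M) : IsMarkovKernel E.episodeKernel :=
  ⟨fun π => by
    change IsProbabilityMeasure (Measure.pi (fun p => E.trajLaw p (π p)))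
    infer_instance⟩

/-- The law of the records of the next `n + 1` steps of player `p` who starts at `s`, executes
`π`, and moves from `s` to `x`. -/
def rolloutVia (E : Environment G A M) (p : Fin M) (π : Policy S A) (n : ℕ) (s : Fin S)
    (x : Option (Fin S)) : Measure (Fin (n + 1) → Step S A) :=
  ((E.reward p s (π s) : Measure I).prod (E.rollout p π n x)).map
    (fun y => (Fin.cons (Sum.inl (s, π s, y.1)) y.2 : Fin (n + 1) → Step S A))

instance (E : Environment G A M) (p : Fin M) (π : Policy S A) (n : ℕ) (s : Fin S)
    (x : Option (Fin S)) : IsProbabilityMeasure (E.rolloutVia p π n s x) :=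
  Measure.isProbabilityMeasure_map (measurable_cons s (π s)).aemeasurable

theorem prod_finsetSum_smul {ι α β : Type*} [MeasurableSpace α] [MeasurableSpace β]
    (s : Finset ι) (μ : Measure α) [IsProbabilityMeasure μ] (c : ι → ENNReal)
    (ν : ι → Measure β) [∀ i, IsProbabilityMeasure (ν i)] :
    μ.prod (∑ i ∈ s, c i • ν i) = ∑ i ∈ s, c i • μ.prod (ν i) := by
  classical
  induction s using Finset.induction_on with
  | empty => simp
  | insert a s ha ih =>
    have : SFinite (∑ i ∈ s, c i • ν i) := by
      rw [← Measure.sum_coe_finset]; infer_instance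
    rw [Finset.sum_insert ha, Finset.sum_insert ha, Measure.prod_add, ih, Measure.prod_smul_right]

/-- The law of a rollout is the mixture, over the next state, of the laws of the rollouts that move
to it. -/
theorem rollout_succ (E : Environment G A M) (p : Fin M) (π : Policy S A) (n : ℕ) (s : Fin S) :
    E.rollout p π (n + 1) (some s) = ∑ x, E.trans p s (π s) x • E.rolloutVia p π n s x := by
  unfold rolloutVia
  rw [rollout, prod_finsetSum_smul,
    Measure.map_finset_sum (measurable_cons s (π s)).aemeasurable]
  simp_rw [Measure.map_smul]

theorem ae_state_rollout (E : Environment G A M) (p : Fin M) (π : Policy S A) (n : ℕ)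
    (x : Option (Fin S)) : ∀ᵐ τ ∂E.rollout p π (n + 1) x, Step.state (τ 0) = x := by
  have hm : MeasurableSet {τ : Fin (n + 1) → Step S A | Step.state (τ 0) = x} :=
    (measurable_pi_apply 0 : Measurable fun τ : Fin (n + 1) → Step S A => τ 0)
      (Step.measurableSet_state_eq x)
  cases x with
  | none =>
    rw [rollout]
    exact (ae_dirac_iff hm).2 rfl
  | some s =>
    rw [rollout, ae_map_iff (measurable_cons s (π s)).aemeasurable hm]
    exact ae_of_all _ fun y => rfl

theorem ae_pair_rolloutVia (E : Environment G A M) (p : Fin M) (π : Policy S A) (n : ℕ)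
    (s : Fin S) (x : Option (Fin S)) :
    ∀ᵐ τ ∂E.rolloutVia p π (n + 1) s x,
      Step.pair (τ 0) = some (s, π s) ∧ Step.state (τ 1) = x := by
  have hm : MeasurableSet {τ : Fin (n + 1 + 1) → Step S A |
      Step.pair (τ 0) = some (s, π s) ∧ Step.state (τ 1) = x} :=
    ((measurable_pi_apply 0 : Measurable fun τ : Fin (n + 1 + 1) → Step S A => τ 0)
      (Step.measurableSet_pair_eq (some (s, π s)))).inter
      ((measurable_pi_apply 1 : Measurable fun τ : Fin (n + 1 + 1) → Step S A => τ 1)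
        (Step.measurableSet_state_eq x))
  rw [rolloutVia, ae_map_iff (measurable_cons s (π s)).aemeasurable hm]
  have h := (E.ae_state_rollout p π n x)
  have h2 := (Measure.quasiMeasurePreserving_snd (μ := (E.reward p s (π s) : Measure I))
    (ν := E.rollout p π (n + 1) x)).ae h
  filter_upwards [h2] with y hy
  exact ⟨rfl, hy⟩

end Environment
end MPERL

namespace MPERL
namespace Environment

variable {S H A M : ℕ} {G : Setting S H}

/-! ### Change of measure for one trajectory -/

/-- Two environments that differ only in the transition probabilities out of the first layer,
which moreover have the same null sets. -/
structure Comparable (E E' : Environment G A M) : Prop where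
  reward_eq : E'.reward = E.reward
  trans_eq : ∀ p s a, G.layer s ≠ 1 → E'.trans p s a = E.trans p s a
  zero_iff : ∀ p s a x, E'.trans p s a x = 0 ↔ E.trans p s a x = 0

/-- The logarithm of the likelihood ratio of the transition `(s, a) → x`. -/
def logRatio (E E' : Environment G A M) (p : Fin M) (s : Fin S) (a : Fin A)
    (x : Option (Fin S)) : ℝ :=
  Real.log ((E'.trans p s a x).toReal / (E.trans p s a x).toReal)

/-- The log-likelihood ratio of a trajectory of player `p`: it involves only the first transition,
which is read off from the first two records. -/
def logLik (E E' : Environment G A M) (p : Fin M) (τ : Fin H → Step S A) : ℝ :=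
  if h : 2 ≤ H then
    (τ ⟨0, by omega⟩).pair.elim 0 fun y => logRatio E E' p y.1 y.2 (τ ⟨1, by omega⟩).state
  else 0

/-- The Kullback–Leibler divergence between the transition laws `E.trans p s a` and
`E'.trans p s a`. -/
def klTrans (E E' : Environment G A M) (p : Fin M) (s : Fin S) (a : Fin A) : ℝ :=
  -∑ x, (E.trans p s a x).toReal * logRatio E E' p s a x

theorem measurable_logLik (E E' : Environment G A M) (p : Fin M) :
    Measurable (logLik E E' p) := by
  unfold logLik
  split_ifs with h
  · let _ : MeasurableSpace (Option (Fin S)) := ⊤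
    let _ : MeasurableSpace (Option (Fin S × Fin A)) := ⊤
    have h1 : Measurable (Step.state : Step S A → Option (Fin S)) :=
      measurable_to_countable' fun o => Step.measurableSet_state_eq o
    have h2 : Measurable (Step.pair : Step S A → Option (Fin S × Fin A)) :=
      measurable_to_countable' fun o => Step.measurableSet_pair_eq o
    have e0 : Measurable fun τ : Fin H → Step S A => τ ⟨0, by omega⟩ := measurable_pi_apply _
    have e1 : Measurable fun τ : Fin H → Step S A => τ ⟨1, by omega⟩ := measurable_pi_apply _
    exact (measurable_of_countable (fun z : Option (Fin S × Fin A) × Option (Fin S) =>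
      (z.1.elim 0 fun y => logRatio E E' p y.1 y.2 z.2 : ℝ))).comp
      ((h2.comp e0).prodMk (h1.comp e1))
  · exact measurable_const

theorem exists_abs_logLik_le (E E' : Environment G A M) (p : Fin M) :
    ∃ B : ℝ, ∀ τ, |logLik E E' p τ| ≤ B := by
  have hfin : (Set.range fun z : Option (Fin S × Fin A) × Option (Fin S) =>
      |(z.1.elim 0 fun y => logRatio E E' p y.1 y.2 z.2 : ℝ)|).Finite := Set.finite_range _
  obtain ⟨B, hB⟩ := hfin.bddAbove
  refine ⟨max B 0, fun τ => ?_⟩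
  unfold logLik
  split_ifs with h
  · exact le_max_of_le_left (hB ⟨((τ ⟨0, by omega⟩).pair, (τ ⟨1, by omega⟩).state), rfl⟩)
  · simp

namespace Comparable

variable {E E' : Environment G A M}

theorem ofReal_exp_logRatio_mul (hE : Comparable E E') (p : Fin M) (s : Fin S) (a : Fin A)
    (x : Option (Fin S)) :
    ENNReal.ofReal (Real.exp (logRatio E E' p s a x)) * E.trans p s a x = E'.trans p s a x := by
  by_cases h0 : E.trans p s a x = 0
  · rw [h0, (hE.zero_iff p s a x).2 h0, mul_zero]
  · have h0' : E'.trans p s a x ≠ 0 := fun h => h0 ((hE.zero_iff p s a x).1 h)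
    have h1 := ENNReal.toReal_pos h0 ((E.trans p s a).apply_ne_top x)
    have h1' := ENNReal.toReal_pos h0' ((E'.trans p s a).apply_ne_top x)
    rw [logRatio, Real.exp_log (div_pos h1' h1),
      ← ENNReal.ofReal_toReal ((E.trans p s a).apply_ne_top x), ← ENNReal.ofReal_mul (by positivity),
      ENNReal.toReal_ofReal h1.le, div_mul_cancel₀ _ h1.ne',
      ENNReal.ofReal_toReal ((E'.trans p s a).apply_ne_top x)]

/-- Comparable environments have the same rollouts beyond the first layer, since layering never
leads back into it. -/
theorem rollout_eq (hE : Comparable E E') (p : Fin M) (π : Policy S A) (n : ℕ)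
    (x : Option (Fin S)) (hx : G.stage x ≠ 1) : E'.rollout p π n x = E.rollout p π n x := by
  induction n generalizing x with
  | zero => simp only [rollout]
  | succ n ih =>
    cases x with
    | none => simp only [rollout]
    | some s =>
      rw [rollout_succ, rollout_succ, hE.trans_eq p s (π s) hx]
      refine Finset.sum_congr rfl fun y _ => ?_
      by_cases h0 : E.trans p s (π s) y = 0
      · rw [h0, zero_smul, zero_smul]
      · have hy := E.layered p s (π s) y ((PMF.mem_support_iff _ _).2 h0)
        have := G.one_le_layer s
        rw [rolloutVia, rolloutVia, hE.reward_eq, ih y (by omega)]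

end Comparable

/-- The trajectory law as a mixture over the first transition `s → x`. -/
theorem trajLaw_eq_sum {n : ℕ} {G : Setting S (n + 2)} (E : Environment G A M) (p : Fin M)
    (π : Policy S A) :
    E.trajLaw p π = ∑ z : Fin S × Option (Fin S),
      (G.init z.1 * E.trans p z.1 (π z.1) z.2) • E.rolloutVia p π (n + 1) z.1 z.2 := by
  rw [Fintype.sum_prod_type]
  unfold trajLaw
  refine Finset.sum_congr rfl fun s _ => ?_
  rw [rollout_succ, Finset.smul_sum]
  simp_rw [smul_smul]

/-- The trajectory laws of comparable environments are mixtures of the same components, with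
different weights. -/
theorem Comparable.trajLaw_eq_sum {n : ℕ} {G : Setting S (n + 2)} {E E' : Environment G A M}
    (hE : Comparable E E') (p : Fin M) (π : Policy S A) :
    E'.trajLaw p π = ∑ z : Fin S × Option (Fin S),
      (G.init z.1 * E'.trans p z.1 (π z.1) z.2) • E.rolloutVia p π (n + 1) z.1 z.2 := by
  rw [Environment.trajLaw_eq_sum]
  refine Finset.sum_congr rfl fun z _ => ?_
  by_cases h0 : E'.trans p z.1 (π z.1) z.2 = 0
  · rw [h0, mul_zero, zero_smul, zero_smul]
  · have hy := E'.layered p z.1 (π z.1) z.2 ((PMF.mem_support_iff _ _).2 h0)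
    have := G.one_le_layer z.1
    rw [rolloutVia, rolloutVia, hE.reward_eq, hE.rollout_eq p π _ _ (by omega)]

theorem ae_logLik_rolloutVia {n : ℕ} {G : Setting S (n + 2)} (E E' : Environment G A M) (p : Fin M)
    (π : Policy S A) (s : Fin S) (x : Option (Fin S)) :
    ∀ᵐ τ ∂E.rolloutVia p π (n + 1) s x, logLik E E' p τ = logRatio E E' p s (π s) x := by
  filter_upwards [E.ae_pair_rolloutVia p π n s x] with τ hτ
  have h2 : 2 ≤ n + 2 := by omega
  unfold logLik
  rw [dif_pos h2]
  have h0 : (⟨0, by omega⟩ : Fin (n + 2)) = 0 := rfl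
  have h1 : (⟨1, by omega⟩ : Fin (n + 2)) = 1 := rfl
  rw [h0, h1, hτ.1, hτ.2]
  rfl

/-- The log-likelihood ratio is almost surely constant on each component of the mixture, where it
transforms the weight under `E` into the weight under `E'`. -/
theorem Comparable.trajLaw_eq_withDensity (hH : 2 ≤ H) {E E' : Environment G A M}
    (hE : Comparable E E') (p : Fin M) (π : Policy S A) :
    E'.trajLaw p π = (E.trajLaw p π).withDensity
      (fun τ => ENNReal.ofReal (Real.exp (logLik E E' p τ))) := by
  obtain ⟨n, rfl⟩ : ∃ n, H = n + 2 := ⟨H - 2, by omega⟩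
  rw [hE.trajLaw_eq_sum, E.trajLaw_eq_sum, withDensity_finsetSum]
  refine Finset.sum_congr rfl fun z _ => ?_
  rw [withDensity_smul_measure]
  have hae : (fun τ => ENNReal.ofReal (Real.exp (logLik E E' p τ)))
      =ᵐ[E.rolloutVia p π (n + 1) z.1 z.2]
      fun _ => ENNReal.ofReal (Real.exp (logRatio E E' p z.1 (π z.1) z.2)) := by
    filter_upwards [ae_logLik_rolloutVia E E' p π z.1 z.2] with τ hτ
    rw [hτ]
  rw [withDensity_congr_ae hae, withDensity_const, smul_smul,
    ← hE.ofReal_exp_logRatio_mul p z.1 (π z.1) z.2]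
  congr 1
  ring

theorem integral_logLik (hH : 2 ≤ H) (E E' : Environment G A M) (p : Fin M) (π : Policy S A) :
    ∫ τ, logLik E E' p τ ∂E.trajLaw p π =
      -∑ s, (G.init s).toReal * klTrans E E' p s (π s) := by
  obtain ⟨n, rfl⟩ : ∃ n, H = n + 2 := ⟨H - 2, by omega⟩
  have hc : ∀ z : Fin S × Option (Fin S), G.init z.1 * E.trans p z.1 (π z.1) z.2 ≠ ⊤ := fun z =>
    ENNReal.mul_ne_top (G.init.apply_ne_top _) ((E.trans p z.1 (π z.1)).apply_ne_top _)
  have hint : ∀ z : Fin S × Option (Fin S),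
      Integrable (logLik E E' p) (E.rolloutVia p π (n + 1) z.1 z.2) := fun z => by
    obtain ⟨B, hB⟩ := exists_abs_logLik_le E E' p
    exact Integrable.of_bound (measurable_logLik E E' p).aestronglyMeasurable B
      (ae_of_all _ hB)
  rw [E.trajLaw_eq_sum, integral_finsetSum_measure fun z _ => (hint z).smul_measure (hc z),
    Fintype.sum_prod_type, ← Finset.sum_neg_distrib]
  refine Finset.sum_congr rfl fun s _ => ?_
  rw [klTrans, mul_neg, neg_neg, Finset.mul_sum]
  refine Finset.sum_congr rfl fun x _ => ?_
  rw [integral_smul_measure, integral_congr_ae (ae_logLik_rolloutVia E E' p π s x), integral_const]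
  simp [mul_assoc]

end Environment
end MPERL

namespace MPERL

variable {S H A M : ℕ} {G : Setting S H}

/-! ### Change of measure for histories -/

namespace Environment

/-- The log-likelihood ratio of an episode of all players. -/
def episodeLogLik (E E' : Environment G A M) (e : Episode S A H M) : ℝ :=
  ∑ p, logLik E E' p (e.2 p)

/-- The Kullback–Leibler divergence between the laws of an episode under `E` and `E'`, when the
players execute the policies `π`. -/
def klEpisode (E E' : Environment G A M) (π : JointPolicy S A M) : ℝ :=
  ∑ p, ∑ s, (G.init s).toReal * klTrans E E' p s (π p s)

theorem measurable_episodeLogLik (E E' : Environment G A M) : Measurable (episodeLogLik E E') :=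
  Finset.measurable_sum _ fun p _ =>
    (measurable_logLik E E' p).comp ((measurable_pi_apply p).comp measurable_snd)

theorem exists_abs_episodeLogLik_le (E E' : Environment G A M) :
    ∃ B : ℝ, ∀ e, |episodeLogLik E E' e| ≤ B := by
  choose B hB using exists_abs_logLik_le E E'
  exact ⟨∑ p, B p, fun e => (Finset.abs_sum_le_sum_abs _ _).trans
    (Finset.sum_le_sum fun p _ => hB p _)⟩

theorem episodeKernel_apply (E : Environment G A M) (π : JointPolicy S A M) :
    E.episodeKernel π = Measure.pi (fun p => E.trajLaw p (π p)) := rfl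

theorem Comparable.episodeKernel_eq_withDensity (hH : 2 ≤ H) {E E' : Environment G A M}
    (hE : Comparable E E') (π : JointPolicy S A M) :
    E'.episodeKernel π = (E.episodeKernel π).withDensity
      (fun τ => ENNReal.ofReal (Real.exp (episodeLogLik E E' (π, τ)))) := by
  have hp : ∀ p, IsProbabilityMeasure ((E.trajLaw p (π p)).withDensity
      (fun τ => ENNReal.ofReal (Real.exp (logLik E E' p τ)))) := fun p => by
    rw [← hE.trajLaw_eq_withDensity hH]; infer_instance
  rw [episodeKernel_apply, episodeKernel_apply]
  simp_rw [hE.trajLaw_eq_withDensity hH]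
  rw [pi_withDensity_prod _ (fun p τ => ENNReal.ofReal (Real.exp (logLik E E' p τ)))
    fun p => (measurable_logLik E E' p).exp.ennreal_ofReal]
  congr 1
  funext τ
  rw [episodeLogLik, Real.exp_sum, ENNReal.ofReal_prod_of_nonneg fun p _ => (Real.exp_pos _).le]

theorem integral_episodeLogLik (hH : 2 ≤ H) (E E' : Environment G A M) (π : JointPolicy S A M) :
    ∫ τ, episodeLogLik E E' (π, τ) ∂E.episodeKernel π = -klEpisode E E' π := by
  have hmp : ∀ p, MeasurePreserving (fun τ : Fin M → Fin H → Step S A => τ p)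
      (Measure.pi fun p => E.trajLaw p (π p)) (E.trajLaw p (π p)) := fun p =>
    measurePreserving_eval (fun p => E.trajLaw p (π p)) p
  have hint : ∀ p, Integrable (fun τ : Fin M → Fin H → Step S A => logLik E E' p (τ p))
      (Measure.pi fun p => E.trajLaw p (π p)) := fun p => by
    obtain ⟨B, hB⟩ := exists_abs_logLik_le E E' p
    exact Integrable.of_bound
      ((measurable_logLik E E' p).comp (measurable_pi_apply p)).aestronglyMeasurable B
      (ae_of_all _ fun τ => hB _)
  rw [episodeKernel_apply]
  unfold episodeLogLik klEpisode
  rw [integral_finsetSum _ fun p _ => hint p, ← Finset.sum_neg_distrib]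
  refine Finset.sum_congr rfl fun p _ => ?_
  rw [← integral_logLik hH, ← (hmp p).map_eq,
    integral_map (hmp p).measurable.aemeasurable (measurable_logLik E E' p).aestronglyMeasurable]

end Environment

open Environment

namespace Algorithm

variable (alg : Algorithm S A H M)

instance (K k : ℕ) : IsMarkovKernel (alg.next K k) := alg.isMarkov K k

/-- The law of the episode that follows the history of the first `k` episodes. -/
def nextEpisode (E : Environment G A M) (K k : ℕ) :
    Kernel (Fin k → Episode S A H M) (Episode S A H M) :=
  (alg.next K k).compProd (Kernel.prodMkLeft _ E.episodeKernel)

instance (E : Environment G A M) (K k : ℕ) : IsMarkovKernel (alg.nextEpisode E K k) := by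
  unfold nextEpisode; infer_instance

theorem measurable_snoc {α : Type*} [MeasurableSpace α] (k : ℕ) :
    Measurable (fun y : (Fin k → α) × α => (Fin.snoc y.1 y.2 : Fin (k + 1) → α)) := by
  refine measurable_pi_iff.2 fun i => ?_
  refine Fin.lastCases ?_ (fun j => ?_) i
  · simpa using measurable_snd
  · have hj : Measurable fun y : (Fin k → α) × α => y.1 j :=
      (measurable_pi_apply j).comp measurable_fst
    simpa using hj

theorem historyLaw_succ (E : Environment G A M) (K k : ℕ) :
    alg.historyLaw E K (k + 1) = ((alg.historyLaw E K k).compProd (alg.nextEpisode E K k)).map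
      (fun y => (Fin.snoc y.1 y.2 : Fin (k + 1) → Episode S A H M)) := rfl

instance (E : Environment G A M) (K k : ℕ) : IsProbabilityMeasure (alg.historyLaw E K k) := by
  induction k with
  | zero => unfold historyLaw; infer_instance
  | succ k ih =>
    rw [historyLaw_succ]
    exact Measure.isProbabilityMeasure_map (measurable_snoc k).aemeasurable

theorem lintegral_nextEpisode (E : Environment G A M) (K k : ℕ) (h : Fin k → Episode S A H M)
    {f : Episode S A H M → ENNReal} (hf : Measurable f) :
    ∫⁻ e, f e ∂alg.nextEpisode E K k h =
      ∫⁻ π, ∫⁻ τ, f (π, τ) ∂E.episodeKernel π ∂alg.next K k h := by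
  rw [nextEpisode, Kernel.lintegral_compProd _ _ _ hf]
  rfl

theorem lintegral_historyLaw_succ (E : Environment G A M) (K k : ℕ)
    {f : (Fin (k + 1) → Episode S A H M) → ENNReal} (hf : Measurable f) :
    ∫⁻ h, f h ∂alg.historyLaw E K (k + 1) =
      ∫⁻ h, ∫⁻ e, f (Fin.snoc h e) ∂alg.nextEpisode E K k h ∂alg.historyLaw E K k := by
  rw [historyLaw_succ, lintegral_map hf (measurable_snoc k)]
  exact Measure.lintegral_compProd (hf.comp (measurable_snoc k))

theorem lintegral_nextEpisode_of_comparable (hH : 2 ≤ H) {E E' : Environment G A M}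
    (hE : Comparable E E') (K k : ℕ) (h : Fin k → Episode S A H M)
    {f : Episode S A H M → ENNReal} (hf : Measurable f) :
    ∫⁻ e, f e ∂alg.nextEpisode E' K k h =
      ∫⁻ e, ENNReal.ofReal (Real.exp (episodeLogLik E E' e)) * f e ∂alg.nextEpisode E K k h := by
  have hm : Measurable fun e => ENNReal.ofReal (Real.exp (episodeLogLik E E' e)) :=
    (measurable_episodeLogLik E E').exp.ennreal_ofReal
  rw [lintegral_nextEpisode _ _ _ _ _ hf]
  refine Eq.trans ?_ (lintegral_nextEpisode alg E K k h (hm.mul hf)).symm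
  refine lintegral_congr fun π => ?_
  rw [hE.episodeKernel_eq_withDensity hH]
  exact lintegral_withDensity_eq_lintegral_mul _ (hm.comp measurable_prodMk_left)
    (hf.comp measurable_prodMk_left)

/-- The log-likelihood ratio of a history. -/
def historyLogLik (E E' : Environment G A M) {k : ℕ} (h : Fin k → Episode S A H M) : ℝ :=
  ∑ i, episodeLogLik E E' (h i)

theorem measurable_historyLogLik (E E' : Environment G A M) (k : ℕ) :
    Measurable (historyLogLik E E' (k := k)) :=
  Finset.measurable_sum _ fun i _ => (measurable_episodeLogLik E E').comp (measurable_pi_apply i)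

/-- The algorithm's choices have the same conditional law under both environments, so only the
episodes contribute to the likelihood ratio of a history. -/
theorem historyLaw_eq_withDensity (hH : 2 ≤ H) {E E' : Environment G A M}
    (hE : Comparable E E') (K k : ℕ) :
    alg.historyLaw E' K k = (alg.historyLaw E K k).withDensity
      (fun h => ENNReal.ofReal (Real.exp (historyLogLik E E' h))) := by
  have hm : ∀ k, Measurable fun h : Fin k → Episode S A H M =>
      ENNReal.ofReal (Real.exp (historyLogLik E E' h)) := fun k =>
    (measurable_historyLogLik E E' k).exp.ennreal_ofReal
  induction k with
  | zero => simp [historyLaw, historyLogLik]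
  | succ k ih =>
    refine Measure.ext_of_lintegral _ fun f hf => ?_
    rw [lintegral_withDensity_eq_lintegral_mul _ (hm _) hf,
      lintegral_historyLaw_succ _ _ _ _ hf, lintegral_historyLaw_succ _ _ _ _ ((hm _).mul hf), ih]
    have hs : ∀ h : Fin k → Episode S A H M,
        Measurable fun e : Episode S A H M => (Fin.snoc h e : Fin (k + 1) → Episode S A H M) :=
      fun h => (measurable_snoc k).comp measurable_prodMk_left
    have hf2 : Measurable fun y : (Fin k → Episode S A H M) × Episode S A H M =>
        f (Fin.snoc y.1 y.2) := hf.comp (measurable_snoc k)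
    have hm2 : Measurable fun h => ∫⁻ e, f (Fin.snoc h e) ∂alg.nextEpisode E' K k h :=
      Measurable.lintegral_kernel_prod_right (κ := alg.nextEpisode E' K k)
        (f := fun h e => f (Fin.snoc h e)) hf2
    rw [lintegral_withDensity_eq_lintegral_mul _ (hm _) hm2]
    refine lintegral_congr fun h => ?_
    have h1 := lintegral_nextEpisode_of_comparable alg hH hE K k h (hf.comp (hs h))
    simp only [Function.comp_apply] at h1
    rw [Pi.mul_apply, h1, ← lintegral_const_mul' _ _ ENNReal.ofReal_ne_top]
    refine lintegral_congr fun e => ?_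
    rw [Pi.mul_apply, historyLogLik, historyLogLik, Fin.sum_univ_castSucc]
    simp only [Fin.snoc_castSucc, Fin.snoc_last]
    rw [Real.exp_add, ENNReal.ofReal_mul (Real.exp_pos _).le, mul_assoc]

/-- A functional of an episode with mean zero under every joint policy has a sum with mean zero
along the history, however the algorithm chooses the policies. -/
theorem integral_sum_eq_zero (E : Environment G A M) (K k : ℕ) {D : Episode S A H M → ℝ}
    (hD : Measurable D) {B : ℝ} (hB : ∀ e, |D e| ≤ B)
    (h0 : ∀ π, ∫ τ, D (π, τ) ∂E.episodeKernel π = 0) :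
    ∫ h, ∑ i, D (h i) ∂alg.historyLaw E K k = 0 := by
  have hint : ∀ (α : Type) [MeasurableSpace α] (μ : Measure α) [IsProbabilityMeasure μ]
      (g : α → Episode S A H M), Measurable g → Integrable (fun x => D (g x)) μ :=
    fun α _ μ _ g hg => Integrable.of_bound (hD.comp hg).aestronglyMeasurable B
      (ae_of_all _ fun x => hB _)
  induction k with
  | zero => simp
  | succ k ih =>
    have hms : ∀ k, Measurable fun h : Fin k → Episode S A H M => ∑ i, D (h i) := fun k =>
      Finset.measurable_sum _ fun i _ => hD.comp (measurable_pi_apply i)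
    rw [historyLaw_succ, integral_map (measurable_snoc k).aemeasurable
      (hms (k + 1)).aestronglyMeasurable]
    simp only [Fin.sum_univ_castSucc, Fin.snoc_castSucc, Fin.snoc_last]
    have h1 : ∫ y, ∑ i, D (y.1 i) ∂(alg.historyLaw E K k).compProd (alg.nextEpisode E K k) = 0 := by
      rw [← ih]
      nth_rewrite 2 [← Measure.fst_compProd (alg.historyLaw E K k) (alg.nextEpisode E K k)]
      rw [Measure.fst, integral_map measurable_fst.aemeasurable (hms k).aestronglyMeasurable]
    have h2 : ∫ y, D y.2 ∂(alg.historyLaw E K k).compProd (alg.nextEpisode E K k) = 0 := by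
      rw [Measure.integral_compProd (hint _ _ _ measurable_snd)]
      refine integral_eq_zero_of_ae (ae_of_all _ fun h => ?_)
      change ∫ e, D e ∂alg.nextEpisode E K k h = 0
      rw [nextEpisode]
      refine (ProbabilityTheory.integral_compProd (f := D) (hint _ _ id measurable_id)).trans ?_
      exact integral_eq_zero_of_ae (ae_of_all _ h0)
    have h3 : Integrable (fun y : (Fin k → Episode S A H M) × Episode S A H M => ∑ i, D (y.1 i))
        ((alg.historyLaw E K k).compProd (alg.nextEpisode E K k)) :=
      integrable_finsetSum _ fun i _ => hint _ _ _ ((measurable_pi_apply i).comp measurable_fst)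
    rw [integral_add h3 (hint _ _ _ measurable_snd), h1, h2, add_zero]

end Algorithm
end MPERL

/-! ### Lower bounds on the information gathered by a sublinear regret algorithm -/

/-- A form of the Bretagnolle–Huber inequality: two probability measures that are close in relative
entropy (which is `-∫ X`) cannot be told apart by any test `B` without error. -/
theorem exp_integral_sub_one_le {Ω : Type*} [MeasurableSpace Ω] (μ : Measure Ω)
    [IsProbabilityMeasure μ] {X : Ω → ℝ} (hX : Measurable X) (hXi : Integrable X μ)
    [IsProbabilityMeasure (μ.withDensity fun ω => ENNReal.ofReal (Real.exp (X ω)))]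
    {B : Set Ω} (hB : MeasurableSet B) :
    Real.exp (∫ ω, X ω ∂μ - 1) ≤
      μ.real B + (μ.withDensity fun ω => ENNReal.ofReal (Real.exp (X ω))).real Bᶜ := by
  have hpos : 0 ≤ᵐ[μ] fun ω => Real.exp (X ω) := ae_of_all _ fun ω => (Real.exp_pos _).le
  have hl : ∫⁻ ω, ENNReal.ofReal (Real.exp (X ω)) ∂μ = 1 := by
    rw [← setLIntegral_univ, ← withDensity_apply _ MeasurableSet.univ, measure_univ]
  have hei : Integrable (fun ω => Real.exp (X ω)) μ :=
    ⟨hX.exp.aestronglyMeasurable, by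
      rw [hasFiniteIntegral_iff_ofReal hpos, hl]; exact ENNReal.one_lt_top⟩
  have he1 : ∫ ω, Real.exp (X ω) ∂μ = 1 := by
    rw [integral_eq_lintegral_of_nonneg_ae hpos hX.exp.aestronglyMeasurable, hl]; rfl
  have hBc : (μ.withDensity fun ω => ENNReal.ofReal (Real.exp (X ω))).real Bᶜ =
      ∫ ω, Bᶜ.indicator (fun ω => Real.exp (X ω)) ω ∂μ := by
    rw [integral_indicator hB.compl, measureReal_def, withDensity_apply _ hB.compl,
      integral_eq_lintegral_of_nonneg_ae (ae_restrict_of_ae hpos) hX.exp.aestronglyMeasurable]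
  have hi1 : Integrable (B.indicator (1 : Ω → ℝ)) μ := (integrable_const (1 : ℝ)).indicator hB
  rw [hBc, ← integral_indicator_one hB, ← integral_add hi1 (hei.indicator hB.compl)]
  have hXi' : Integrable (fun ω => X ω - Real.exp (X ω)) μ := hXi.sub hei
  set t : ℝ := 1 - ∫ ω, X ω ∂μ with ht
  -- the tangent to `exp` at `-t`, evaluated at the lower bound `X - exp X` of `min 0 X`
  have hg : Real.exp (∫ ω, X ω ∂μ - 1) =
      ∫ ω, Real.exp (-t) * ((1 + t) + (X ω - Real.exp (X ω))) ∂μ := by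
    rw [integral_const_mul, integral_add (integrable_const _) hXi',
      integral_sub hXi hei, he1, integral_const, ht]
    simp
    ring
  rw [hg]
  refine integral_mono (((integrable_const _).add hXi').const_mul _)
    (hi1.add (hei.indicator hB.compl)) fun ω => ?_
  have h1 : Real.exp (-t) * ((1 + t) + (X ω - Real.exp (X ω))) ≤
      Real.exp (X ω - Real.exp (X ω)) := by
    have h2 := Real.add_one_le_exp (X ω - Real.exp (X ω) + t)
    have h3 : Real.exp (X ω - Real.exp (X ω)) =
        Real.exp (-t) * Real.exp (X ω - Real.exp (X ω) + t) := by
      rw [← Real.exp_add]; congr 1; ring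
    rw [h3]
    exact mul_le_mul_of_nonneg_left (by linarith) (Real.exp_pos _).le
  refine h1.trans ?_
  have h4 := Real.add_one_le_exp (X ω)
  have h5 := Real.exp_pos (X ω)
  by_cases hω : ω ∈ B
  · simp only [Set.indicator_of_mem hω, Set.indicator_of_notMem (fun h => h hω : ω ∉ Bᶜ),
      Pi.one_apply, add_zero]
    rw [← Real.exp_zero]
    exact Real.exp_le_exp.2 (by linarith)
  · simp only [Set.indicator_of_notMem hω, Set.indicator_of_mem (Set.mem_compl hω), zero_add]
    exact Real.exp_le_exp.2 (by linarith only [h5])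

namespace MPERL

open Environment

variable {S H A M : ℕ} {G : Setting S H}

namespace Algorithm

variable (alg : Algorithm S A H M)

theorem measurable_policySum (k : ℕ) (f : JointPolicy S A M → ℝ) :
    Measurable fun h : Fin k → Episode S A H M => ∑ i, f (h i).1 :=
  Finset.measurable_sum _ fun i _ =>
    (measurable_of_countable f).comp (measurable_fst.comp (measurable_pi_apply i))

theorem integrable_policySum (E : Environment G A M) (K k : ℕ) (f : JointPolicy S A M → ℝ) :
    Integrable (fun h => ∑ i, f (h i).1) (alg.historyLaw E K k) := by
  refine integrable_finsetSum _ fun i _ => ?_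
  obtain ⟨B, hB⟩ := (Set.finite_range fun π => |f π|).bddAbove
  exact Integrable.of_bound ((measurable_of_countable f).comp
    (measurable_fst.comp (measurable_pi_apply i))).aestronglyMeasurable B
    (ae_of_all _ fun h => hB ⟨(h i).1, rfl⟩)

/-- The divergence decomposition: the relative entropy of the laws of the history is the expected
sum of the divergences of the episodes. -/
theorem integral_historyLogLik (hH : 2 ≤ H) (E E' : Environment G A M) (K k : ℕ) :
    Integrable (historyLogLik E E') (alg.historyLaw E K k) ∧
    ∫ h, historyLogLik E E' h ∂alg.historyLaw E K k =
      -∫ h, ∑ i, klEpisode E E' (h i).1 ∂alg.historyLaw E K k := by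
  obtain ⟨B, hB⟩ := exists_abs_episodeLogLik_le E E'
  have hi : Integrable (historyLogLik E E') (alg.historyLaw E K k) :=
    integrable_finsetSum _ fun i _ => Integrable.of_bound
      ((measurable_episodeLogLik E E').comp (measurable_pi_apply i)).aestronglyMeasurable B
      (ae_of_all _ fun h => hB _)
  obtain ⟨B', hB'⟩ := (Set.finite_range fun π => |klEpisode E E' π|).bddAbove
  have hm : Measurable fun e : Episode S A H M => klEpisode E E' e.1 :=
    (measurable_of_countable (klEpisode E E')).comp measurable_fst
  have h0 := alg.integral_sum_eq_zero E K k (D := fun e => episodeLogLik E E' e + klEpisode E E' e.1)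
    ((measurable_episodeLogLik E E').add hm) (B := B + B')
    (fun e => (abs_add_le _ _).trans (add_le_add (hB e) (hB' ⟨e.1, rfl⟩)))
    (fun π => by
      rw [integral_add, integral_episodeLogLik hH]
      · simp
      · exact Integrable.of_bound
          ((measurable_episodeLogLik E E').comp measurable_prodMk_left).aestronglyMeasurable B
          (ae_of_all _ fun τ => hB _)
      · exact integrable_const (μ := E.episodeKernel π) (klEpisode E E' π))
  refine ⟨hi, ?_⟩
  simp only [Finset.sum_add_distrib] at h0
  rw [integral_add (f := fun h : Fin k → Episode S A H M => ∑ i, episodeLogLik E E' (h i)) hi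
    (alg.integrable_policySum E K k _)] at h0
  exact eq_neg_of_add_eq_zero_left h0

theorem exp_neg_kl_le (hH : 2 ≤ H) {E E' : Environment G A M} (hE : Comparable E E') (K k : ℕ)
    {B : Set (Fin k → Episode S A H M)} (hB : MeasurableSet B) :
    Real.exp (-(∫ h, ∑ i, klEpisode E E' (h i).1 ∂alg.historyLaw E K k) - 1) ≤
      (alg.historyLaw E K k).real B + (alg.historyLaw E' K k).real Bᶜ := by
  have hd := alg.historyLaw_eq_withDensity hH hE K k
  have hp : IsProbabilityMeasure ((alg.historyLaw E K k).withDensity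
      (fun h => ENNReal.ofReal (Real.exp (historyLogLik E E' h)))) := by
    rw [← hd]; infer_instance
  obtain ⟨h1, h2⟩ := alg.integral_historyLogLik hH E E' K k
  rw [← h2, hd]
  exact exp_integral_sub_one_le _ (measurable_historyLogLik E E' k) h1 hB

/-- The regret of one episode in which the players execute the policies `π`. -/
def episodeRegret (E : Environment G A M) (π : JointPolicy S A M) : ℝ :=
  ∑ p, (E.optValue₀ p - E.value₀ p (π p))

theorem expectedRegret_eq (E : Environment G A M) (K : ℕ) :
    alg.expectedRegret E K = ∫ h, ∑ k, episodeRegret E (h k).1 ∂alg.historyLaw E K K := by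
  unfold expectedRegret episodeRegret
  simp_rw [Finset.sum_comm (s := (Finset.univ : Finset (Fin M)))]

/-- Markov's inequality for a quantity `f` of the joint policy that costs a regret of `w` per unit. -/
theorem measureReal_le_of_regret (E : Environment G A M) {K : ℕ} (hK : 1 ≤ K) {w : ℝ} (hw : 0 < w)
    (f : JointPolicy S A M → ℝ) (hf : ∀ π, 0 ≤ f π) (hR : ∀ π, w * f π ≤ episodeRegret E π) :
    (alg.historyLaw E K K).real {h | (K : ℝ) / 2 ≤ ∑ i, f (h i).1} ≤
      2 / (w * K) * alg.expectedRegret E K := by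
  have hK' : (0 : ℝ) < K := by exact_mod_cast hK
  have h1 := mul_meas_ge_le_integral_of_nonneg (μ := alg.historyLaw E K K)
    (ae_of_all _ fun h => Finset.sum_nonneg fun i _ => hf (h i).1)
    (alg.integrable_policySum E K K f) ((K : ℝ) / 2)
  have h2 : w * ∫ h, ∑ i, f (h i).1 ∂alg.historyLaw E K K ≤ alg.expectedRegret E K := by
    rw [expectedRegret_eq, ← integral_const_mul]
    refine integral_mono ((alg.integrable_policySum E K K f).const_mul w)
      (alg.integrable_policySum E K K _) fun h => ?_
    simp only [Finset.mul_sum]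
    exact Finset.sum_le_sum fun i _ => hR _
  have h3 : w * K / 2 * (alg.historyLaw E K K).real {h | (K : ℝ) / 2 ≤ ∑ i, f (h i).1} ≤
      alg.expectedRegret E K := by
    calc _ = w * ((K : ℝ) / 2 * (alg.historyLaw E K K).real
            {h | (K : ℝ) / 2 ≤ ∑ i, f (h i).1}) := by ring
      _ ≤ _ := (mul_le_mul_of_nonneg_left h1 hw.le).trans h2
  rw [div_mul_eq_mul_div, le_div_iff₀ (by positivity)]
  linarith

/-- A sublinear regret algorithm has to tell `E` from `E'` if executing `a` in `s` is costly for
player `p` under `E`, and not executing it is costly under `E'`. -/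
theorem eventually_log_le_integral_kl (hH : 2 ≤ H) {E E' : Environment G A M}
    (hE : Comparable E E') {ε C α w : ℝ} (halg : alg.IsSublinear G ε C α)
    (hd : E.IsDissimilar ε) (hd' : E'.IsDissimilar ε) (p : Fin M) (s : Fin S) (a : Fin A)
    (hw : 0 < w) (hR0 : ∀ π, 0 ≤ episodeRegret E π) (hR0' : ∀ π, 0 ≤ episodeRegret E' π)
    (hR : ∀ π : JointPolicy S A M, π p s = a → w ≤ episodeRegret E π)
    (hR' : ∀ π : JointPolicy S A M, π p s ≠ a → w ≤ episodeRegret E' π) :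
    ∀ᶠ K : ℕ in atTop, (1 - α) / 2 * Real.log K ≤
      ∫ h, ∑ i, klEpisode E E' (h i).1 ∂alg.historyLaw E K K := by
  obtain ⟨hC, hα, hsub⟩ := halg
  have hlim : Tendsto (fun K : ℕ => (1 - α) / 2 * Real.log K) atTop atTop :=
    (Real.tendsto_log_atTop.comp tendsto_natCast_atTop_atTop).const_mul_atTop (by linarith)
  filter_upwards [hlim.eventually_ge_atTop (1 + Real.log (4 * C / w)), eventually_ge_atTop 1]
    with K hKlog hK
  have hK' : (0 : ℝ) < K := by exact_mod_cast hK
  set f : JointPolicy S A M → ℝ := fun π => if π p s = a then 1 else 0 with hf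
  set f' : JointPolicy S A M → ℝ := fun π => if π p s = a then 0 else 1 with hf'
  have hff : ∀ h : Fin K → Episode S A H M, ∑ i, f' (h i).1 = K - ∑ i, f (h i).1 := fun h => by
    rw [eq_sub_iff_add_eq, ← Finset.sum_add_distrib]
    have : ∀ i, f' (h i).1 + f (h i).1 = 1 := fun i => by
      simp only [hf, hf']; split_ifs <;> simp
    simp [this]
  -- the test: has player `p` been made to execute `a` in `s` in at least half of the episodes?
  set B : Set (Fin K → Episode S A H M) := {h | (K : ℝ) / 2 ≤ ∑ i, f (h i).1} with hBdef
  have hB : MeasurableSet B := measurableSet_le measurable_const (measurable_policySum K f)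
  have h1 := alg.exp_neg_kl_le hH hE K K hB
  have h2 := alg.measureReal_le_of_regret E hK hw f
    (fun π => by simp only [hf]; split_ifs <;> simp)
    (fun π => by
      simp only [hf]
      split_ifs with h
      · rw [mul_one]; exact hR π h
      · rw [mul_zero]; exact hR0 π)
  have h3 := alg.measureReal_le_of_regret E' hK hw f'
    (fun π => by simp only [hf']; split_ifs <;> simp)
    (fun π => by
      simp only [hf']
      split_ifs with h
      · rw [mul_zero]; exact hR0' π
      · rw [mul_one]; exact hR' π h)
  have h4 : (alg.historyLaw E' K K).real Bᶜ ≤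
      (alg.historyLaw E' K K).real {h | (K : ℝ) / 2 ≤ ∑ i, f' (h i).1} := by
    refine measureReal_mono fun h hh => ?_
    simp only [hBdef, Set.mem_compl_iff, Set.mem_ofPred_eq, not_le] at hh
    simp only [Set.mem_ofPred_eq, hff]
    linarith
  have hc : 0 ≤ 2 / (w * K) := by positivity
  have h5 := mul_le_mul_of_nonneg_left (hsub E hd K hK) hc
  have h6 := mul_le_mul_of_nonneg_left (hsub E' hd' K hK) hc
  have h7 : Real.exp (-(∫ h, ∑ i, klEpisode E E' (h i).1 ∂alg.historyLaw E K K) - 1) ≤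
      4 * C / w * (K : ℝ) ^ (α - 1) := by
    have h8 : 4 * C / w * (K : ℝ) ^ (α - 1) = 2 * (2 / (w * K) * (C * (K : ℝ) ^ α)) := by
      rw [Real.rpow_sub_one hK'.ne']
      field_simp
      ring
    rw [h8]
    linarith
  have h9 := Real.log_le_log (Real.exp_pos _) h7
  rw [Real.log_exp, Real.log_mul (by positivity) (by positivity), Real.log_rpow hK'] at h9
  linarith

end Algorithm
end MPERL

namespace MPERL
namespace Environment

variable {S H A M : ℕ} {G : Setting S H}

/-! ### Bellman equations and the regret as a sum of gaps -/

theorem expectNext_congr (E : Environment G A M) (p : Fin M) {f g : Option (Fin S) → ℝ} (s : Fin S)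
    (a : Fin A) (h : ∀ x, G.stage x = G.layer s + 1 → f x = g x) :
    E.expectNext p f s a = E.expectNext p g s a := by
  refine Finset.sum_congr rfl fun x _ => ?_
  by_cases h0 : E.trans p s a x = 0
  · simp [h0]
  · rw [h x (E.layered p s a x ((PMF.mem_support_iff _ _).2 h0))]

theorem optValue_none (E : Environment G A M) (p : Fin M) : E.optValue p none = 0 := by
  simp [optValue, Setting.stage, optValueAux]

theorem optValue_some (E : Environment G A M) (p : Fin M) (s : Fin S) :
    E.optValue p (some s) = ⨆ a, E.optQ p s a := by
  have h1 : H + 1 - G.stage (some s) = (H - G.layer s) + 1 := by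
    have := G.layer_le s
    simp only [Setting.stage]; omega
  unfold optValue optQ
  rw [h1, optValueAux]
  congr 1
  funext a
  congr 1
  refine E.expectNext_congr p s a fun x hx => ?_
  unfold optValue
  rw [hx, Nat.add_sub_add_right]

theorem value_some (E : Environment G A M) (p : Fin M) (π : Policy S A) (s : Fin S) :
    E.value p π (some s) = E.meanReward p s (π s) + E.expectNext p (E.value p π) s (π s) := by
  have h1 : H + 1 - G.stage (some s) = (H - G.layer s) + 1 := by
    have := G.layer_le s
    simp only [Setting.stage]; omega
  unfold value
  rw [h1, valueAux]
  congr 1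
  refine E.expectNext_congr p s _ fun x hx => ?_
  rw [hx, Nat.add_sub_add_right]

theorem gap_nonneg (E : Environment G A M) (p : Fin M) (s : Fin S) (a : Fin A) :
    0 ≤ E.gap p s a := by
  rw [gap, optValue_some, sub_nonneg]
  exact le_ciSup (Set.finite_range _).bddAbove a

theorem value_eq_optValue (E : Environment G A M) (p : Fin M) (π : Policy S A)
    (h0 : ∀ s a, G.layer s ≠ 1 → E.gap p s a = 0) (n : ℕ) (x : Option (Fin S))
    (hx : G.stage x + n = H + 1) (hx1 : G.stage x ≠ 1) : E.value p π x = E.optValue p x := by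
  induction n generalizing x with
  | zero =>
    have : H + 1 - G.stage x = 0 := by omega
    rw [value, optValue, this, valueAux, optValueAux]
  | succ n ih =>
    cases x with
    | none => simp [value, optValue, Setting.stage, valueAux, optValueAux]
    | some s =>
      have h1 := h0 s (π s) hx1
      rw [gap, sub_eq_zero] at h1
      rw [value_some, h1, optQ]
      congr 1
      refine E.expectNext_congr p s _ fun y hy => ?_
      simp only [Setting.stage] at hx hx1
      have := G.one_le_layer s
      exact ih y (by omega) (by omega)

/-- If the gaps vanish beyond the first layer, then the regret of a policy is its expected gap at
the initial state. -/
theorem optValue₀_sub_value₀ (E : Environment G A M) (p : Fin M) (π : Policy S A)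
    (h0 : ∀ s a, G.layer s ≠ 1 → E.gap p s a = 0) :
    E.optValue₀ p - E.value₀ p π = ∑ s, (G.init s).toReal * E.gap p s (π s) := by
  rw [optValue₀, value₀, ← Finset.sum_sub_distrib]
  refine Finset.sum_congr rfl fun s _ => ?_
  rw [← mul_sub, gap, optQ, value_some]
  congr 3
  refine E.expectNext_congr p s _ fun y hy => ?_
  have h1 := G.one_le_layer s
  have h2 := G.layer_le s
  exact E.value_eq_optValue p π h0 (H - G.layer s) y (by omega) (by omega)

end Environment
end MPERL

namespace MPERL

/-! ### The tower instances -/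

theorem sum_ite_ite {α R : Type*} [Fintype α] [DecidableEq α] [AddCommMonoid R] {x y : α}
    (hxy : x ≠ y) (u v : R) :
    ∑ z, (if z = x then u else if z = y then v else 0) = u + v := by
  have h : ∀ z, (if z = x then u else if z = y then v else 0) =
      (if z = x then u else 0) + if z = y then v else 0 := fun z => by
    by_cases h1 : z = x
    · simp [h1, hxy]
    · simp [h1]
  simp [h, Finset.sum_add_distrib]

/-- The size of the first layer. -/
abbrev firstSize (S H : ℕ) : ℕ := S - 2 * (H - 1)

/-- The states of the first layer. -/
def firstLayer (S H : ℕ) : Finset (Fin S) := Finset.univ.filter fun s => (s : ℕ) < firstSize S H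

theorem mem_firstLayer {S H : ℕ} {s : Fin S} : s ∈ firstLayer S H ↔ (s : ℕ) < firstSize S H := by
  rw [firstLayer, Finset.mem_filter, and_iff_right (Finset.mem_univ s)]

theorem firstLayer_nonempty {S H : ℕ} (hS : 2 * (H - 1) < S) : (firstLayer S H).Nonempty :=
  ⟨⟨0, by omega⟩, mem_firstLayer.2 (by simp only [firstSize]; omega)⟩

theorem card_firstLayer (S H : ℕ) : (firstLayer S H).card = firstSize S H := by
  rw [firstLayer, Fin.card_filter_val_lt]; simp only [firstSize]; omega

/-- The setting whose first layer consists of the states `s < firstSize S H`, with the uniform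
initial distribution on it, and whose layers `2, …, H` consist of two consecutive states each. -/
def towerSetting {S H : ℕ} (hH : 2 ≤ H) (hS : 2 * (H - 1) < S) : Setting S H where
  layer s := if (s : ℕ) < firstSize S H then 1 else 2 + (s - firstSize S H) / 2
  one_le_layer s := by split_ifs <;> omega
  layer_le s := by
    have := s.isLt
    simp only [firstSize]
    split_ifs <;> omega
  init := PMF.uniformOfFinset (firstLayer S H) (firstLayer_nonempty hS)
  layer_init s hs := by
    rw [PMF.mem_support_uniformOfFinset_iff, mem_firstLayer] at hs
    exact if_pos hs

variable {S H : ℕ} (hH : 2 ≤ H) (hS : 2 * (H - 1) < S)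

theorem towerSetting_layer (s : Fin S) : (towerSetting hH hS).layer s =
    if (s : ℕ) < firstSize S H then 1 else 2 + (s - firstSize S H) / 2 := rfl

theorem towerSetting_layer_eq_one_iff (s : Fin S) :
    (towerSetting hH hS).layer s = 1 ↔ (s : ℕ) < firstSize S H := by
  rw [towerSetting_layer]; split_ifs with h <;> simp [h]; omega

theorem card_towerSetting_layer (h : ℕ) (h2 : 2 ≤ h) (hh : h ≤ H) :
    Fintype.card {s : Fin S // (towerSetting hH hS).layer s = h} = 2 := by
  rw [Fintype.card_subtype]
  have hlt : firstSize S H + 2 * (h - 2) + 1 < S := by simp only [firstSize]; omega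
  have : (Finset.univ.filter fun s : Fin S => (towerSetting hH hS).layer s = h) =
      {⟨firstSize S H + 2 * (h - 2), by omega⟩, ⟨firstSize S H + 2 * (h - 2) + 1, hlt⟩} := by
    ext s
    rw [Finset.mem_filter, and_iff_right (Finset.mem_univ s), towerSetting_layer,
      Finset.mem_insert, Finset.mem_singleton, Fin.ext_iff, Fin.ext_iff]
    dsimp only
    split_ifs <;> omega
  rw [this, Finset.card_pair]
  simp [Fin.ext_iff]

theorem towerSetting_init (s : Fin S) :
    (towerSetting hH hS).init s =
      if (s : ℕ) < firstSize S H then ((firstSize S H : ℕ) : ENNReal)⁻¹ else 0 := by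
  change PMF.uniformOfFinset (firstLayer S H) (firstLayer_nonempty hS) s = _
  rw [PMF.uniformOfFinset_apply, card_firstLayer]
  simp only [mem_firstLayer]

/-- The rewarding state of the second layer. -/
def good : Fin S := ⟨firstSize S H, by simp only [firstSize]; omega⟩

/-- The worthless state of the second layer. -/
def bad : Fin S := ⟨firstSize S H + 1, by simp only [firstSize]; omega⟩

theorem good_ne_bad : some (good hH hS) ≠ some (bad hH hS) := by
  simp [good, bad]

/-- The law of the second state if the good one is reached with probability `r`. -/
def firstMove (r : I) : PMF (Option (Fin S)) :=
  PMF.ofFintype (fun x => if x = some (good hH hS) then ENNReal.ofReal r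
    else if x = some (bad hH hS) then ENNReal.ofReal (1 - r) else 0) (by
      rw [sum_ite_ite (good_ne_bad hH hS),
        ← ENNReal.ofReal_add r.2.1 (sub_nonneg.2 r.2.2)]
      simp)

theorem firstMove_apply (r : I) (x : Option (Fin S)) : firstMove hH hS r x =
    if x = some (good hH hS) then ENNReal.ofReal r
      else if x = some (bad hH hS) then ENNReal.ofReal (1 - r) else 0 := rfl

theorem firstMove_toReal (r : I) (x : Option (Fin S)) : (firstMove hH hS r x).toReal =
    if x = some (good hH hS) then (r : ℝ) else if x = some (bad hH hS) then 1 - r else 0 := by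
  rw [firstMove_apply]
  split_ifs
  · exact ENNReal.toReal_ofReal r.2.1
  · exact ENNReal.toReal_ofReal (sub_nonneg.2 r.2.2)
  · rfl

/-- The state of the next layer with the same parity. -/
def ascend (s : Fin S) : Option (Fin S) :=
  if h : (s : ℕ) + 2 < S then some ⟨s + 2, h⟩ else none

/-- In a tower instance, an action in the first layer leads to one of the two states of the second
layer: to the good one with probability `q p s a`. From then on, the player passes
deterministically through the good (or bad) states of all layers, whatever the actions, and
receives a reward of `1` (or `0`) in each. -/
def tower {A M : ℕ} (q : Fin M → Fin S → Fin A → I) : Environment (towerSetting hH hS) A M where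
  trans p s a := if (s : ℕ) < firstSize S H then firstMove hH hS (q p s a)
    else PMF.pure (ascend s)
  layered p s a x hx := by
    rw [towerSetting_layer]
    split_ifs at hx ⊢ with h
    · rw [PMF.mem_support_iff, firstMove_apply] at hx
      split_ifs at hx with h1 h2
      · rw [h1]; simp [Setting.stage, towerSetting_layer, good]
      · rw [h2]; simp [Setting.stage, towerSetting_layer, bad]
      · exact absurd rfl hx
    · rw [PMF.mem_support_pure_iff] at hx
      rw [hx, ascend]
      have := s.isLt
      split_ifs with h1
      · simp only [Setting.stage, towerSetting_layer]
        split_ifs <;> omega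
      · simp only [Setting.stage, firstSize] at *
        omega
  reward p s a := ⟨Measure.dirac
    (if firstSize S H ≤ s ∧ (s - firstSize S H) % 2 = 0 then 1 else 0), inferInstance⟩

variable {A M : ℕ} (q : Fin M → Fin S → Fin A → I)

theorem tower_trans (p : Fin M) (s : Fin S) (a : Fin A) : (tower hH hS q).trans p s a =
    if (s : ℕ) < firstSize S H then firstMove hH hS (q p s a) else PMF.pure (ascend s) := rfl

theorem tower_meanReward (p : Fin M) (s : Fin S) (a : Fin A) : (tower hH hS q).meanReward p s a =
    if firstSize S H ≤ s ∧ (s - firstSize S H) % 2 = 0 then 1 else 0 := by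
  have h : (tower hH hS q).meanReward p s a = ∫ x : I, (x : ℝ) ∂(Measure.dirac
    (if firstSize S H ≤ s ∧ (s - firstSize S H) % 2 = 0 then 1 else 0 : I)) := rfl
  rw [h, integral_dirac]
  split_ifs <;> simp

theorem tower_expectNext_first (p : Fin M) (f : Option (Fin S) → ℝ) {s : Fin S} (a : Fin A)
    (hs : (s : ℕ) < firstSize S H) : (tower hH hS q).expectNext p f s a =
      q p s a * f (some (good hH hS)) + (1 - q p s a) * f (some (bad hH hS)) := by
  simp only [Environment.expectNext, tower_trans, if_pos hs, firstMove_toReal]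
  rw [← sum_ite_ite (good_ne_bad hH hS)]
  refine Finset.sum_congr rfl fun x _ => ?_
  split_ifs with h1 h2
  · rw [h1]
  · rw [h2]
  · rw [zero_mul]

theorem tower_expectNext_of_le (p : Fin M) (f : Option (Fin S) → ℝ) {s : Fin S} (a : Fin A)
    (hs : firstSize S H ≤ (s : ℕ)) : (tower hH hS q).expectNext p f s a = f (ascend s) := by
  simp only [Environment.expectNext, tower_trans, if_neg (not_lt.2 hs), PMF.pure_apply]
  rw [Finset.sum_eq_single (ascend s)]
  · simp
  · intro x _ hx
    simp [hx]
  · simp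

theorem tower_optQ_of_le (p : Fin M) {s : Fin S} (a : Fin A)
    (hs : firstSize S H ≤ (s : ℕ)) : (tower hH hS q).optQ p s a =
      (if (s - firstSize S H) % 2 = 0 then 1 else 0) + (tower hH hS q).optValue p (ascend s) := by
  rw [Environment.optQ, tower_meanReward, tower_expectNext_of_le hH hS q p _ a hs]
  simp [hs]

variable [NeZero A]

theorem tower_optValue_of_le (p : Fin M) {s : Fin S} (hs : firstSize S H ≤ (s : ℕ)) :
    (tower hH hS q).optValue p (some s) =
      (if (s - firstSize S H) % 2 = 0 then 1 else 0) + (tower hH hS q).optValue p (ascend s) := by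
  rw [Environment.optValue_some]
  simp_rw [tower_optQ_of_le hH hS q p _ hs]
  exact ciSup_const

theorem tower_gap_of_le (p : Fin M) {s : Fin S} (a : Fin A) (hs : firstSize S H ≤ (s : ℕ)) :
    (tower hH hS q).gap p s a = 0 := by
  rw [Environment.gap, tower_optValue_of_le hH hS q p hs, tower_optQ_of_le hH hS q p a hs, sub_self]

theorem tower_optValue_closed_form (p : Fin M) (n : ℕ) {s : Fin S}
    (hs : firstSize S H ≤ (s : ℕ)) (hn : (towerSetting hH hS).layer s + n = H + 1) :
    (tower hH hS q).optValue p (some s) = if (s - firstSize S H) % 2 = 0 then (n : ℝ) else 0 := by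
  induction n generalizing s with
  | zero => exact absurd ((towerSetting hH hS).layer_le s) (by omega)
  | succ n ih =>
    rw [tower_optValue_of_le hH hS q p hs, ascend]
    rw [towerSetting_layer, if_neg (not_lt.2 hs)] at hn
    split_ifs with h1 h2 h2
    · rw [ih (s := ⟨s + 2, h2⟩) (by simp only; omega) (by
        rw [towerSetting_layer, if_neg (by simp only; omega)]; simp only; omega), if_pos (by
        simp only; omega)]
      push_cast; ring
    · have : n = 0 := by simp only [firstSize] at *; omega
      rw [Environment.optValue_none, this]; simp
    · rw [ih (s := ⟨s + 2, h2⟩) (by simp only; omega) (by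
        rw [towerSetting_layer, if_neg (by simp only; omega)]; simp only; omega), if_neg (by
        simp only; omega), add_zero]
    · rw [Environment.optValue_none, add_zero]

theorem tower_optQ_first (p : Fin M) {s : Fin S} (a : Fin A) (hs : (s : ℕ) < firstSize S H) :
    (tower hH hS q).optQ p s a = q p s a * ((H : ℝ) - 1) := by
  have hgood : (tower hH hS q).optValue p (some (good hH hS)) = (H : ℝ) - 1 := by
    rw [tower_optValue_closed_form hH hS q p (H - 1) (by simp [good]) (by
      rw [towerSetting_layer]; simp [good]; omega), if_pos (by simp [good]),
      Nat.cast_sub (by omega), Nat.cast_one]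
  have hbad : (tower hH hS q).optValue p (some (bad hH hS)) = 0 := by
    rw [tower_optValue_closed_form hH hS q p (H - 1) (by simp [bad]) (by
      rw [towerSetting_layer]; simp [bad]; omega), if_neg (by simp [bad])]
  rw [Environment.optQ, tower_meanReward, if_neg (by omega),
    tower_expectNext_first hH hS q p _ a hs, hgood, hbad]
  ring

theorem tower_gap_first (p : Fin M) {s : Fin S} (a : Fin A) (hs : (s : ℕ) < firstSize S H) :
    (tower hH hS q).gap p s a = (⨆ b, (q p s b : ℝ) * ((H : ℝ) - 1)) - q p s a * ((H : ℝ) - 1) := by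
  rw [Environment.gap, Environment.optValue_some]
  simp_rw [tower_optQ_first hH hS q p _ hs]

theorem tower_episodeRegret (π : JointPolicy S A M) :
    Algorithm.episodeRegret (tower hH hS q) π =
      ∑ p, ∑ s, ((towerSetting hH hS).init s).toReal * (tower hH hS q).gap p s (π p s) := by
  refine Finset.sum_congr rfl fun p _ => Environment.optValue₀_sub_value₀ _ p _ fun s a hs => ?_
  rw [Ne, towerSetting_layer_eq_one_iff, not_lt] at hs
  exact tower_gap_of_le hH hS q p a hs

end MPERL

namespace MPERL

/-! ### Tower instances with prescribed advantages -/

variable {S H : ℕ} (hH : 2 ≤ H) (hS : 2 * (H - 1) < S) {A M : ℕ}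

/-- The tower instance in which the value of the action `a` in the state `s` of the first layer
exceeds `(H - 1) / 2` by `θ p s a`. The probability of reaching the good state is clipped to
`[0, 1]`, which has no effect if `|θ p s a| ≤ H / 48`. -/
def advantageTower (θ : Fin M → Fin S → Fin A → ℝ) : Environment (towerSetting hH hS) A M :=
  tower hH hS fun p s a => Set.projIcc (0 : ℝ) 1 zero_le_one (1 / 2 + θ p s a / ((H : ℝ) - 1))

theorem abs_div_le (hH : 2 ≤ H) {t : ℝ} (ht : |t| ≤ (H : ℝ) / 48) : |t / ((H : ℝ) - 1)| ≤ 1 / 24 := by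
  have h2 : (2 : ℝ) ≤ H := by exact_mod_cast hH
  rw [abs_div, abs_of_pos (by linarith : (0 : ℝ) < (H : ℝ) - 1), div_le_iff₀ (by linarith)]
  linarith

theorem coe_projIcc_half_add (hH : 2 ≤ H) {t : ℝ} (ht : |t| ≤ (H : ℝ) / 48) :
    (Set.projIcc (0 : ℝ) 1 zero_le_one (1 / 2 + t / ((H : ℝ) - 1)) : ℝ) =
      1 / 2 + t / ((H : ℝ) - 1) := by
  have h := abs_le.1 (abs_div_le hH ht)
  rw [Set.projIcc_of_mem zero_le_one ⟨by linarith [h.1], by linarith [h.2]⟩]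

variable {θ θ' : Fin M → Fin S → Fin A → ℝ}

theorem advantageTower_gap [NeZero A] (hθ : ∀ p s a, |θ p s a| ≤ (H : ℝ) / 48) (p : Fin M)
    {s : Fin S} (a : Fin A) (hs : (s : ℕ) < firstSize S H) :
    (advantageTower hH hS θ).gap p s a = (⨆ b, θ p s b) - θ p s a := by
  have h2 : (2 : ℝ) ≤ H := by exact_mod_cast hH
  have hq : ∀ b, (Set.projIcc (0 : ℝ) 1 zero_le_one (1 / 2 + θ p s b / ((H : ℝ) - 1)) : ℝ) *
      ((H : ℝ) - 1) = ((H : ℝ) - 1) / 2 + θ p s b := fun b => by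
    have h1 : (H : ℝ) - 1 ≠ 0 := by linarith
    rw [coe_projIcc_half_add hH (hθ p s b)]
    field_simp
  rw [advantageTower, tower_gap_first hH hS _ p a hs]
  simp_rw [hq]
  rw [← add_ciSup (Set.finite_range _).bddAbove]
  ring

theorem advantageTower_gap_of_le [NeZero A] (p : Fin M) {s : Fin S} (a : Fin A)
    (hs : firstSize S H ≤ (s : ℕ)) : (advantageTower hH hS θ).gap p s a = 0 :=
  tower_gap_of_le hH hS _ p a hs

theorem sub_le_advantageTower_gap [NeZero A] (hθ : ∀ p s a, |θ p s a| ≤ (H : ℝ) / 48) (p : Fin M)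
    {s : Fin S} (a b : Fin A) (hs : (s : ℕ) < firstSize S H) :
    θ p s a - θ p s b ≤ (advantageTower hH hS θ).gap p s b := by
  rw [advantageTower_gap hH hS hθ p b hs]
  linarith [le_ciSup (f := fun b => θ p s b) (Set.finite_range _).bddAbove a]

theorem advantageTower_trans_toReal (hθ : ∀ p s a, |θ p s a| ≤ (H : ℝ) / 48) (p : Fin M)
    {s : Fin S} (a : Fin A) (hs : (s : ℕ) < firstSize S H) (x : Option (Fin S)) :
    ((advantageTower hH hS θ).trans p s a x).toReal =
      if x = some (good hH hS) then 1 / 2 + θ p s a / ((H : ℝ) - 1)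
      else if x = some (bad hH hS) then 1 / 2 - θ p s a / ((H : ℝ) - 1) else 0 := by
  rw [advantageTower, tower_trans, if_pos hs, firstMove_toReal, coe_projIcc_half_add hH (hθ p s a)]
  congr 2
  ring

theorem advantageTower_isDissimilar {ε : ℝ} (hε : 0 ≤ ε)
    (hθ : ∀ p s a, |θ p s a| ≤ (H : ℝ) / 48)
    (hd : ∀ p q s a, |θ p s a - θ q s a| ≤ ε / 4) : (advantageTower hH hS θ).IsDissimilar ε := by
  intro p q s a
  have h2 : (2 : ℝ) ≤ H := by exact_mod_cast hH
  refine ⟨by simpa only [advantageTower, tower_meanReward, sub_self, abs_zero] using hε, ?_⟩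
  by_cases hs : (s : ℕ) < firstSize S H
  · simp only [advantageTower_trans_toReal hH hS hθ _ _ hs]
    have h1 : ∀ x : Option (Fin S),
        |(if x = some (good hH hS) then 1 / 2 + θ p s a / ((H : ℝ) - 1)
          else if x = some (bad hH hS) then 1 / 2 - θ p s a / ((H : ℝ) - 1) else 0) -
        (if x = some (good hH hS) then 1 / 2 + θ q s a / ((H : ℝ) - 1)
          else if x = some (bad hH hS) then 1 / 2 - θ q s a / ((H : ℝ) - 1) else 0)| =
        if x = some (good hH hS) then |θ p s a - θ q s a| / ((H : ℝ) - 1)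
          else if x = some (bad hH hS) then |θ p s a - θ q s a| / ((H : ℝ) - 1) else 0 := by
      intro x
      have h3 : |θ p s a - θ q s a| / ((H : ℝ) - 1) = |(θ p s a - θ q s a) / ((H : ℝ) - 1)| := by
        rw [abs_div, abs_of_pos (by linarith : (0 : ℝ) < (H : ℝ) - 1)]
      rw [h3]
      split_ifs
      · congr 1; ring
      · rw [← abs_neg]; congr 1; ring
      · simp
    simp_rw [h1]
    rw [sum_ite_ite (good_ne_bad hH hS), ← add_div,
      div_le_div_iff₀ (by linarith) (by linarith)]
    nlinarith [hd p q s a]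
  · simp only [advantageTower, tower_trans, if_neg hs, sub_self, abs_zero, Finset.sum_const_zero]
    positivity

theorem advantageTower_comparable (hθ : ∀ p s a, |θ p s a| ≤ (H : ℝ) / 48)
    (hθ' : ∀ p s a, |θ' p s a| ≤ (H : ℝ) / 48) :
    Environment.Comparable (advantageTower hH hS θ) (advantageTower hH hS θ') where
  reward_eq := rfl
  trans_eq p s a hs := by
    rw [Ne, towerSetting_layer_eq_one_iff] at hs
    simp only [advantageTower, tower_trans, if_neg hs]
  zero_iff p s a x := by
    by_cases hs : (s : ℕ) < firstSize S H
    · have key : ∀ {θ : Fin M → Fin S → Fin A → ℝ}, (∀ p s a, |θ p s a| ≤ (H : ℝ) / 48) →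
          ((advantageTower hH hS θ).trans p s a x = 0 ↔
            x ≠ some (good hH hS) ∧ x ≠ some (bad hH hS)) := by
        intro θ hθ
        have h := abs_le.1 (abs_div_le hH (hθ p s a))
        have h0 : ∀ z : ENNReal, z ≠ ⊤ → (z = 0 ↔ z.toReal = 0) := fun z hz => by
          rw [ENNReal.toReal_eq_zero_iff, or_iff_left hz]
        rw [h0 _ (PMF.apply_ne_top _ _), advantageTower_trans_toReal hH hS hθ p a hs]
        split_ifs with h1 h3
        · simp only [h1, ne_eq, not_true_eq_false, false_and, iff_false]; linarith [h.1]
        · simp only [h3, ne_eq, not_true_eq_false, and_false, iff_false]; linarith [h.2]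
        · simp [h1, h3]
      rw [key hθ, key hθ']
    · simp only [advantageTower, tower_trans, if_neg hs]

/-- The relative entropy of two Bernoulli laws is at most their `χ²` divergence, here with success
probabilities close to `1 / 2`. -/
theorem klBernoulli_le {x y : ℝ} (hx : |x| ≤ 1 / 24) (hy : |y| ≤ 1 / 24) :
    -((1 / 2 + x) * Real.log ((1 / 2 + y) / (1 / 2 + x)) +
      (1 / 2 - x) * Real.log ((1 / 2 - y) / (1 / 2 - x))) ≤ 5 * (x - y) ^ 2 := by
  rw [abs_le] at hx hy
  have hx1 : 0 < 1 / 2 + x := by linarith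
  have hx2 : 0 < 1 / 2 - x := by linarith
  have hy1 : 0 < 1 / 2 + y := by linarith
  have hy2 : 0 < 1 / 2 - y := by linarith
  have h1 : -Real.log ((1 / 2 + y) / (1 / 2 + x)) ≤ (1 / 2 + x) / (1 / 2 + y) - 1 := by
    rw [← Real.log_inv, inv_div]
    exact Real.log_le_sub_one_of_pos (div_pos hx1 hy1)
  have h2 : -Real.log ((1 / 2 - y) / (1 / 2 - x)) ≤ (1 / 2 - x) / (1 / 2 - y) - 1 := by
    rw [← Real.log_inv, inv_div]
    exact Real.log_le_sub_one_of_pos (div_pos hx2 hy2)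
  have h3 := mul_le_mul_of_nonneg_left h1 hx1.le
  have h4 := mul_le_mul_of_nonneg_left h2 hx2.le
  have h5 : (1 / 2 + x) * ((1 / 2 + x) / (1 / 2 + y) - 1) +
      (1 / 2 - x) * ((1 / 2 - x) / (1 / 2 - y) - 1) =
      (x - y) ^ 2 / ((1 / 2 + y) * (1 / 2 - y)) := by
    have h0 : ∀ a b u v : ℝ, u ≠ 0 → v ≠ 0 → b = 1 - a → v = 1 - u →
        a * (a / u - 1) + b * (b / v - 1) = (a - u) ^ 2 / (u * v) := by
      intro a b u v hu hv hb hv'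
      field_simp
      rw [hb, hv']
      ring
    rw [h0 _ _ _ _ hy1.ne' hy2.ne' (by ring) (by ring), add_sub_add_left_eq_sub]
  have h6 : (x - y) ^ 2 / ((1 / 2 + y) * (1 / 2 - y)) ≤ 5 * (x - y) ^ 2 := by
    rw [div_le_iff₀ (mul_pos hy1 hy2)]
    have h7 : 1 ≤ 5 * ((1 / 2 + y) * (1 / 2 - y)) := by nlinarith
    nlinarith [sq_nonneg (x - y)]
  linarith

theorem klTrans_advantageTower_le (hθ : ∀ p s a, |θ p s a| ≤ (H : ℝ) / 48)
    (hθ' : ∀ p s a, |θ' p s a| ≤ (H : ℝ) / 48) (p : Fin M) {s : Fin S} (a : Fin A)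
    (hs : (s : ℕ) < firstSize S H) :
    Environment.klTrans (advantageTower hH hS θ) (advantageTower hH hS θ') p s a ≤
      20 * (θ p s a - θ' p s a) ^ 2 / (H : ℝ) ^ 2 := by
  have h2 : (2 : ℝ) ≤ H := by exact_mod_cast hH
  have h1 := klBernoulli_le (abs_div_le hH (hθ p s a)) (abs_div_le hH (hθ' p s a))
  refine le_trans (le_of_eq ?_) (h1.trans ?_)
  · rw [Environment.klTrans, ← sum_ite_ite (good_ne_bad hH hS)]
    congr 1
    refine Finset.sum_congr rfl fun x _ => ?_
    rw [Environment.logRatio, advantageTower_trans_toReal hH hS hθ p a hs,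
      advantageTower_trans_toReal hH hS hθ' p a hs]
    split_ifs <;> simp
  · rw [← sub_div, div_pow, mul_div_assoc', div_le_div_iff₀ (by nlinarith) (by positivity)]
    have h3 : (H : ℝ) ^ 2 ≤ 4 * ((H : ℝ) - 1) ^ 2 := by nlinarith
    nlinarith [mul_le_mul_of_nonneg_left h3 (sq_nonneg (θ p s a - θ' p s a))]

end MPERL

namespace MPERL

/-! ### The regret lower bound on a tower instance -/

open Algorithm Environment

variable {S H : ℕ} (hH : 2 ≤ H) (hS : 2 * (H - 1) < S) {A M : ℕ}

theorem towerSetting_init_pos {s : Fin S} (hs : (s : ℕ) < firstSize S H) :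
    0 < ((towerSetting hH hS).init s).toReal := by
  rw [towerSetting_init, if_pos hs]
  refine ENNReal.toReal_pos (by simp) ?_
  simp only [ne_eq, ENNReal.inv_eq_top, Nat.cast_eq_zero]
  omega

theorem mul_gap_le_episodeRegret [NeZero A] (θ : Fin M → Fin S → Fin A → ℝ) (π : JointPolicy S A M)
    (p : Fin M) (s : Fin S) :
    ((towerSetting hH hS).init s).toReal * (advantageTower hH hS θ).gap p s (π p s) ≤
      episodeRegret (advantageTower hH hS θ) π := by
  have h0 : ∀ p s, 0 ≤ ((towerSetting hH hS).init s).toReal *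
      (advantageTower hH hS θ).gap p s (π p s) := fun p s =>
    mul_nonneg ENNReal.toReal_nonneg (gap_nonneg _ p s _)
  rw [advantageTower, tower_episodeRegret]
  exact (Finset.single_le_sum (fun s _ => h0 p s) (Finset.mem_univ s)).trans
    (Finset.single_le_sum (f := fun p => ∑ s, _) (fun p _ => Finset.sum_nonneg fun s _ => h0 p s)
      (Finset.mem_univ p))

/-- An episode yields information about a change of the advantage of `(s, a)` by `2 * δ` only to the
players affected by the change who execute `a` in `s`; the probability of starting in `s` appears
here as it does in the regret, and cancels in the end. -/
theorem klEpisode_advantageTower_le {θ θ' : Fin M → Fin S → Fin A → ℝ}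
    (hθ : ∀ p s a, |θ p s a| ≤ (H : ℝ) / 48) (hθ' : ∀ p s a, |θ' p s a| ≤ (H : ℝ) / 48)
    (P : Finset (Fin M)) (s : Fin S) (a : Fin A) {δ : ℝ}
    (hch : ∀ p' s' a', (θ p' s' a' - θ' p' s' a') ^ 2 ≤
      if p' ∈ P ∧ s' = s ∧ a' = a then 4 * δ ^ 2 else 0) (π : JointPolicy S A M) :
    klEpisode (advantageTower hH hS θ) (advantageTower hH hS θ') π ≤
      80 * δ ^ 2 / (H : ℝ) ^ 2 * ∑ p ∈ P, ((towerSetting hH hS).init s).toReal *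
        if π p s = a then 1 else 0 := by
  have h1 : ∀ p' s', ((towerSetting hH hS).init s').toReal *
      klTrans (advantageTower hH hS θ) (advantageTower hH hS θ') p' s' (π p' s') ≤
      if p' ∈ P then if s' = s then 80 * δ ^ 2 / (H : ℝ) ^ 2 *
        (((towerSetting hH hS).init s).toReal * if π p' s = a then 1 else 0) else 0 else 0 := by
    intro p' s'
    by_cases hs : (s' : ℕ) < firstSize S H
    · have h3 := klTrans_advantageTower_le hH hS hθ hθ' p' (π p' s') hs
      have h4 := hch p' s' (π p' s')
      have hi : 0 ≤ ((towerSetting hH hS).init s').toReal := ENNReal.toReal_nonneg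
      have h5 : 20 * (θ p' s' (π p' s') - θ' p' s' (π p' s')) ^ 2 / (H : ℝ) ^ 2 ≤
          if p' ∈ P ∧ s' = s ∧ π p' s' = a then 80 * δ ^ 2 / (H : ℝ) ^ 2 else 0 := by
        split_ifs with hc
        · rw [if_pos hc] at h4
          gcongr ?_ / _
          linarith
        · rw [if_neg hc] at h4
          exact div_nonpos_of_nonpos_of_nonneg (by linarith) (by positivity)
      refine (mul_le_mul_of_nonneg_left (h3.trans h5) hi).trans (le_of_eq ?_)
      by_cases hp : p' ∈ P
      · by_cases hs' : s' = s
        · subst hs'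
          by_cases ha : π p' s' = a
          · simp [hp, ha, mul_comm]
          · simp [ha]
        · simp [hs']
      · simp [hp]
    · rw [towerSetting_init, if_neg hs, ENNReal.toReal_zero, zero_mul]
      split_ifs <;> positivity
  refine (Finset.sum_le_sum fun p' _ => Finset.sum_le_sum fun s' _ => h1 p' s').trans (le_of_eq ?_)
  have h2 : ∀ (i : Fin M) (c : ℝ), (∑ j : Fin S, if i ∈ P then if j = s then c else 0 else 0) =
      if i ∈ P then c else 0 := fun i c => by
    split_ifs <;> simp
  simp only [h2, Finset.mul_sum, Finset.sum_ite_mem, Finset.univ_inter]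

/-- Suppose that the alternative instance differs from the base instance with gaps `D` only in the
advantages of the action `a` in the state `s` for the players in `P`, by `2 * δ`, and that
`a` is better than all other actions by `δ` there for some player. Then a sublinear regret
algorithm has to let the players in `P` execute `a` in `s` often. -/
theorem eventually_log_le_integral_count [NeZero A] {D θ' : Fin M → Fin S → Fin A → ℝ} {ε : ℝ}
    (hε : 0 ≤ ε) (hD0 : ∀ p s a, 0 ≤ D p s a) (hDH : ∀ p s a, D p s a ≤ (H : ℝ) / 48)
    (hDε : ∀ p q s a, |D p s a - D q s a| ≤ ε / 4)
    (hDz : ∀ p s, ∃ a, D p s a = 0) (hθ' : ∀ p s a, |θ' p s a| ≤ (H : ℝ) / 48)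
    (hθ'ε : ∀ p q s a, |θ' p s a - θ' q s a| ≤ ε / 4)
    (P : Finset (Fin M)) (p : Fin M) (s : Fin S) (hs : (s : ℕ) < firstSize S H)
    (a : Fin A) {δ : ℝ} (hδ : 0 < δ) (hδD : δ ≤ D p s a) (hδθ : δ ≤ θ' p s a)
    (heq : ∀ p' s' a', ¬ (p' ∈ P ∧ s' = s ∧ a' = a) → θ' p' s' a' = -D p' s' a')
    (hch : ∀ p' ∈ P, θ' p' s a + D p' s a = 2 * δ)
    (alg : Algorithm S A H M) {C α : ℝ} (halg : alg.IsSublinear (towerSetting hH hS) ε C α) :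
    ∀ᶠ K : ℕ in atTop, 1 / 160 * (1 - α) * Real.log K * ((H : ℝ) ^ 2 / δ) ≤
      ∫ h, ∑ k, (∑ p ∈ P, ((towerSetting hH hS).init s).toReal *
          (δ * if (h k).1 p s = a then 1 else 0))
        ∂alg.historyLaw (advantageTower hH hS fun p s a => -D p s a) K K := by
  have hθ : ∀ p s a, |(fun p s a => -D p s a : Fin M → Fin S → Fin A → ℝ) p s a| ≤
      (H : ℝ) / 48 := fun p s a => by
    rw [abs_neg, abs_of_nonneg (hD0 p s a)]; exact hDH p s a
  have hdis := advantageTower_isDissimilar hH hS hε hθ fun p q s a => by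
    rw [← abs_neg]; simpa [sub_eq_add_neg, add_comm] using hDε p q s a
  have hdis' := advantageTower_isDissimilar hH hS hε hθ' hθ'ε
  have hi := towerSetting_init_pos hH hS hs
  have hnn : ∀ (θ : Fin M → Fin S → Fin A → ℝ) π,
      0 ≤ episodeRegret (advantageTower hH hS θ) π := fun θ π =>
    (mul_nonneg ENNReal.toReal_nonneg (gap_nonneg _ p s _)).trans
      (mul_gap_le_episodeRegret hH hS θ π p s)
  filter_upwards [alg.eventually_log_le_integral_kl hH (advantageTower_comparable hH hS hθ hθ') halg
    hdis hdis' p s a (mul_pos hi hδ) (hnn _) (hnn _) (fun π hπ => by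
      refine le_trans (mul_le_mul_of_nonneg_left ?_ hi.le) (mul_gap_le_episodeRegret hH hS _ π p s)
      obtain ⟨b, hb⟩ := hDz p s
      have h1 := sub_le_advantageTower_gap hH hS hθ p b (π p s) hs
      rw [hπ] at h1 ⊢
      simp only [hb] at h1
      linarith) (fun π hπ => by
      refine le_trans (mul_le_mul_of_nonneg_left ?_ hi.le) (mul_gap_le_episodeRegret hH hS _ π p s)
      have h1 := sub_le_advantageTower_gap hH hS hθ' p a (π p s) hs
      rw [heq p s (π p s) fun h => hπ h.2.2] at h1
      linarith [hD0 p s (π p s)])] with K hK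
  have hch' : ∀ p' s' a', ((fun p s a => -D p s a : Fin M → Fin S → Fin A → ℝ) p' s' a' -
      θ' p' s' a') ^ 2 ≤ if p' ∈ P ∧ s' = s ∧ a' = a then 4 * δ ^ 2 else 0 := by
    intro p' s' a'
    split_ifs with h
    · obtain ⟨h1, rfl, rfl⟩ := h
      have h2 := hch p' h1
      have h3 : -D p' s' a' - θ' p' s' a' = -(2 * δ) := by linarith
      simp only [h3]
      exact le_of_eq (by ring)
    · rw [heq p' s' a' h]; simp
  set E := advantageTower hH hS fun p s a => -D p s a with hE
  set cnt : JointPolicy S A M → ℝ := fun π => ∑ p ∈ P, ((towerSetting hH hS).init s).toReal *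
    if π p s = a then 1 else 0 with hcnt
  have hkl : ∫ h, ∑ i, klEpisode E (advantageTower hH hS θ') (h i).1 ∂alg.historyLaw E K K ≤
      80 * δ ^ 2 / (H : ℝ) ^ 2 * ∫ h, ∑ i, cnt (h i).1 ∂alg.historyLaw E K K := by
    rw [← integral_const_mul]
    refine integral_mono (alg.integrable_policySum E K K _)
      ((alg.integrable_policySum E K K cnt).const_mul _) fun h => ?_
    simp only [Finset.mul_sum _ _ (80 * δ ^ 2 / (H : ℝ) ^ 2)]
    exact Finset.sum_le_sum fun i _ =>
      klEpisode_advantageTower_le hH hS hθ hθ' P s a hch' (h i).1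
  have hgoal : ∫ h, ∑ k, (∑ p ∈ P, ((towerSetting hH hS).init s).toReal *
      (δ * if (h k).1 p s = a then 1 else 0)) ∂alg.historyLaw E K K =
      δ * ∫ h, ∑ i, cnt (h i).1 ∂alg.historyLaw E K K := by
    rw [← integral_const_mul]
    congr 1
    funext h
    rw [Finset.mul_sum]
    refine Finset.sum_congr rfl fun i _ => ?_
    rw [hcnt, Finset.mul_sum]
    exact Finset.sum_congr rfl fun p _ => by ring
  rw [hgoal]
  have h2 := hK.trans hkl
  have hH0 : (0 : ℝ) < H := by exact_mod_cast (by omega : 0 < H)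
  generalize ∫ h, ∑ i, cnt (h i).1 ∂alg.historyLaw E K K = N at h2 ⊢
  have h3 : δ * N = (H : ℝ) ^ 2 / (80 * δ) * (80 * δ ^ 2 / (H : ℝ) ^ 2 * N) := by
    field_simp
  rw [h3]
  refine le_trans (le_of_eq ?_) (mul_le_mul_of_nonneg_left h2 (by positivity))
  field_simp
  ring

/-- The expected cost of the episodes in which player `p` executes `x.2` in the state `x.1`. -/
def pairRegret {G : Setting S H} (alg : Algorithm S A H M) (E : Environment G A M) (K : ℕ)
    (p : Fin M) (x : Fin S × Fin A) : ℝ :=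
  ∫ h, ∑ k, (G.init x.1).toReal * (E.gap p x.1 x.2 * if (h k).1 p x.1 = x.2 then 1 else 0)
    ∂alg.historyLaw E K K

theorem pairRegret_nonneg {G : Setting S H} (alg : Algorithm S A H M) (E : Environment G A M)
    (K : ℕ) (p : Fin M) (x : Fin S × Fin A) : 0 ≤ pairRegret alg E K p x :=
  integral_nonneg fun h => Finset.sum_nonneg fun k _ => mul_nonneg ENNReal.toReal_nonneg
    (mul_nonneg (gap_nonneg _ _ _ _) (by split_ifs <;> simp))

theorem expectedRegret_tower_eq [NeZero A] (alg : Algorithm S A H M)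
    (q : Fin M → Fin S → Fin A → I) (K : ℕ) :
    alg.expectedRegret (tower hH hS q) K = ∑ p, ∑ x, pairRegret alg (tower hH hS q) K p x := by
  have hint : ∀ (p : Fin M) (x : Fin S × Fin A), Integrable (fun h : Fin K → Episode S A H M =>
      ∑ k, ((towerSetting hH hS).init x.1).toReal * ((tower hH hS q).gap p x.1 x.2 *
        if (h k).1 p x.1 = x.2 then (1 : ℝ) else 0)) (alg.historyLaw (tower hH hS q) K K) :=
    fun p x => alg.integrable_policySum _ K K fun π => ((towerSetting hH hS).init x.1).toReal *
      ((tower hH hS q).gap p x.1 x.2 * if π p x.1 = x.2 then (1 : ℝ) else 0)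
  unfold pairRegret
  rw [expectedRegret_eq]
  simp_rw [← integral_finsetSum Finset.univ fun x _ => hint _ x]
  rw [← integral_finsetSum Finset.univ fun p _ => integrable_finsetSum _ fun x _ => hint p x]
  congr 1
  funext h
  rw [Finset.sum_congr rfl fun p _ => Finset.sum_comm, Finset.sum_comm]
  refine Finset.sum_congr rfl fun k _ => ?_
  rw [tower_episodeRegret]
  refine Finset.sum_congr rfl fun p _ => ?_
  rw [Fintype.sum_prod_type]
  refine Finset.sum_congr rfl fun s _ => ?_
  simp

end MPERL

namespace MPERL

/-! ### From single pairs to the gap complexity -/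

open Algorithm Environment

variable {S H : ℕ} (hH : 2 ≤ H) (hS : 2 * (H - 1) < S) {A M : ℕ} [NeZero A]
  {D : Fin M → Fin S → Fin A → ℝ} {ε : ℝ}

theorem advantageTower_neg_gap (hD0 : ∀ p s a, 0 ≤ D p s a) (hDH : ∀ p s a, D p s a ≤ (H : ℝ) / 48)
    (hDz : ∀ p s, ∃ a, D p s a = 0)
    (hDs : ∀ p (s : Fin S) a, firstSize S H ≤ s → D p s a = 0) (p : Fin M) (s : Fin S) (a : Fin A) :
    (advantageTower hH hS fun p s a => -D p s a).gap p s a = D p s a := by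
  by_cases hs : (s : ℕ) < firstSize S H
  · rw [advantageTower_gap hH hS (fun p s a => by
      rw [abs_neg, abs_of_nonneg (hD0 p s a)]; exact hDH p s a) p a hs]
    have h1 : (⨆ b, -D p s b) = 0 := by
      obtain ⟨b, hb⟩ := hDz p s
      refine le_antisymm (ciSup_le fun b => by linarith [hD0 p s b]) ?_
      have := le_ciSup (f := fun b => -D p s b) (Set.finite_range _).bddAbove b
      simpa [hb] using this
    rw [h1]; ring
  · rw [advantageTower_gap_of_le hH hS p a (not_lt.1 hs), hDs p s a (not_lt.1 hs)]

/-- The lower bound for a pair with gaps at most `ε / 8`: raising the advantage of the pair for a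
single player preserves `ε`-dissimilarity. -/
theorem eventually_le_pairRegret (hε : 0 ≤ ε) (hD0 : ∀ p s a, 0 ≤ D p s a)
    (hDH : ∀ p s a, D p s a ≤ (H : ℝ) / 48)
    (hDε : ∀ p q s a, |D p s a - D q s a| ≤ ε / 4)
    (hDz : ∀ p s, ∃ a, D p s a = 0)
    (hDs : ∀ p (s : Fin S) a, firstSize S H ≤ s → D p s a = 0)
    (alg : Algorithm S A H M) {C α : ℝ} (halg : alg.IsSublinear (towerSetting hH hS) ε C α)
    (p : Fin M) (x : Fin S × Fin A) (hx : ∀ q, D q x.1 x.2 ≤ ε / 8) (hpos : 0 < D p x.1 x.2) :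
    ∀ᶠ K : ℕ in atTop, 1 / 160 * (1 - α) * Real.log K * ((H : ℝ) ^ 2 / D p x.1 x.2) ≤
      pairRegret alg (advantageTower hH hS fun p s a => -D p s a) K p x := by
  classical
  obtain ⟨s, a⟩ := x
  have hs : (s : ℕ) < firstSize S H := by
    by_contra h
    exact hpos.ne' (hDs p s a (not_lt.1 h))
  have hθ : ∀ p' s' a', |(if p' = p ∧ s' = s ∧ a' = a then D p s a else -D p' s' a')| ≤
      (H : ℝ) / 48 := fun p' s' a' => by
    split_ifs
    · rw [abs_of_pos hpos]; exact hDH p s a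
    · rw [abs_neg, abs_of_nonneg (hD0 _ _ _)]; exact hDH _ _ _
  have hmain := eventually_log_le_integral_count hH hS hε hD0 hDH hDε hDz hθ
    (fun p1 p2 s' a' => by
      have h1 := abs_le.1 (hDε p1 p2 s' a')
      have h2 := hD0 p1 s' a'
      have h3 := hD0 p2 s' a'
      by_cases hsa : s' = s ∧ a' = a
      · obtain ⟨rfl, rfl⟩ := hsa
        have h4 := hx p1
        have h5 := hx p2
        have h6 := hx p
        simp only at h4 h5 h6 hpos
        split_ifs <;> rw [abs_le] <;> constructor <;> linarith
      · rw [if_neg fun h => hsa h.2, if_neg fun h => hsa h.2, abs_le]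
        constructor <;> linarith)
    {p} p s hs a hpos le_rfl (by simp) (fun p' s' a' h => if_neg (by simpa using h))
    (fun p' h => by
      rw [Finset.mem_singleton] at h
      subst h
      rw [if_pos ⟨rfl, rfl, rfl⟩]; ring) alg halg
  refine hmain.mono fun K hK => hK.trans (le_of_eq ?_)
  simp only [pairRegret, Finset.sum_singleton, advantageTower_neg_gap hH hS hD0 hDH hDz hDs]

/-- The lower bound for a pair with positive gaps: raising the advantage of the pair for all players
simultaneously, by twice the smallest gap, preserves the differences between the players. -/
theorem eventually_le_sum_pairRegret (hε : 0 ≤ ε) (hD0 : ∀ p s a, 0 ≤ D p s a)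
    (hDH : ∀ p s a, D p s a ≤ (H : ℝ) / 48)
    (hDε : ∀ p q s a, |D p s a - D q s a| ≤ ε / 4)
    (hDz : ∀ p s, ∃ a, D p s a = 0)
    (hDs : ∀ p (s : Fin S) a, firstSize S H ≤ s → D p s a = 0)
    (alg : Algorithm S A H M) {C α : ℝ} (halg : alg.IsSublinear (towerSetting hH hS) ε C α)
    [Nonempty (Fin M)] (x : Fin S × Fin A) (hpos : ∀ p, 0 < D p x.1 x.2) :
    ∀ᶠ K : ℕ in atTop, 1 / 160 * (1 - α) * Real.log K * ((H : ℝ) ^ 2 / ⨅ p, D p x.1 x.2) ≤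
      ∑ p, pairRegret alg (advantageTower hH hS fun p s a => -D p s a) K p x := by
  classical
  obtain ⟨s, a⟩ := x
  obtain ⟨p, hp⟩ := exists_eq_ciInf_of_finite (f := fun p => D p s a)
  have hmin : ∀ q, D p s a ≤ D q s a := fun q => by
    rw [hp]; exact ciInf_le (Set.finite_range _).bddBelow q
  simp only at hp hpos ⊢
  rw [← hp]
  have hs : (s : ℕ) < firstSize S H := by
    by_contra h
    exact (hpos p).ne' (hDs p s a (not_lt.1 h))
  have hθ : ∀ p' s' a', |(if s' = s ∧ a' = a then 2 * D p s a - D p' s' a' else -D p' s' a')| ≤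
      (H : ℝ) / 48 := fun p' s' a' => by
    have h1 := hDH p' s' a'
    have h2 := hD0 p' s' a'
    split_ifs with h
    · obtain ⟨rfl, rfl⟩ := h
      have h3 := hmin p'
      have h4 := hpos p
      rw [abs_le]
      constructor <;> linarith
    · rw [abs_neg, abs_of_nonneg h2]; exact h1
  have hmain := eventually_log_le_integral_count hH hS hε hD0 hDH hDε hDz hθ
    (fun p1 p2 s' a' => by
      have h1 := abs_le.1 (hDε p1 p2 s' a')
      split_ifs <;> rw [abs_le] <;> constructor <;> linarith)
    Finset.univ p s hs a (hpos p) le_rfl (by rw [if_pos ⟨rfl, rfl⟩]; linarith)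
    (fun p' s' a' h => if_neg (by simpa using h))
    (fun p' _ => by rw [if_pos ⟨rfl, rfl⟩]; ring) alg halg
  refine hmain.mono fun K hK => hK.trans ?_
  set E := advantageTower hH hS fun p s a => -D p s a
  unfold pairRegret
  rw [← integral_finsetSum Finset.univ fun p _ => alg.integrable_policySum E K K fun π =>
    ((towerSetting hH hS).init s).toReal * (E.gap p s a * if π p s = a then (1 : ℝ) else 0)]
  refine integral_mono (alg.integrable_policySum E K K fun π => ∑ q,
    ((towerSetting hH hS).init s).toReal * (D p s a * if π q s = a then (1 : ℝ) else 0))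
    (integrable_finsetSum _ fun p _ => alg.integrable_policySum E K K fun π =>
    ((towerSetting hH hS).init s).toReal * (E.gap p s a * if π p s = a then (1 : ℝ) else 0))
    fun h => ?_
  simp only
  rw [Finset.sum_comm]
  refine Finset.sum_le_sum fun q _ => Finset.sum_le_sum fun k _ => ?_
  refine mul_le_mul_of_nonneg_left (mul_le_mul_of_nonneg_right ?_ (by split_ifs <;> simp))
    ENNReal.toReal_nonneg
  rw [advantageTower_neg_gap hH hS hD0 hDH hDz hDs]
  exact hmin q

/-- The total regret is the sum of the regrets of the pairs, each of which enters exactly one of the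
two lower bounds: the pairs that are not subpar the one for single players, the subpar pairs the one
for all players. -/
theorem eventually_gapComplexity_le (hε : 0 ≤ ε) (hD0 : ∀ p s a, 0 ≤ D p s a)
    (hDH : ∀ p s a, D p s a ≤ (H : ℝ) / 48)
    (hDε : ∀ p q s a, |D p s a - D q s a| ≤ ε / 4)
    (hDz : ∀ p s, ∃ a, D p s a = 0)
    (hDs : ∀ p (s : Fin S) a, firstSize S H ≤ s → D p s a = 0)
    (alg : Algorithm S A H M) {C α : ℝ} (halg : alg.IsSublinear (towerSetting hH hS) ε C α) :
    ∀ᶠ K : ℕ in atTop, 1 / 160 * (1 - α) * Real.log K *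
        gapComplexity (advantageTower hH hS fun p s a => -D p s a) (ε / (768 * H)) ≤
      alg.expectedRegret (advantageTower hH hS fun p s a => -D p s a) K := by
  classical
  have hgap := advantageTower_neg_gap hH hS hD0 hDH hDz hDs
  set E := advantageTower hH hS fun p s a => -D p s a with hE
  have hH0 : (0 : ℝ) < H := by exact_mod_cast (by omega : 0 < H)
  have hsub : ∀ x : Fin S × Fin A, x ∈ E.subpar (ε / (768 * H)) ↔ ∃ p, ε / 8 < D p x.1 x.2 := by
    intro x
    have h1 : 96 * (H : ℝ) * (ε / (768 * H)) = ε / 8 := by field_simp; ring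
    change (∃ p, _) ↔ _
    simp_rw [h1, hgap]
  have ev1 : ∀ᶠ K : ℕ in atTop, ∀ p x, x ∉ E.subpar (ε / (768 * H)) ∧ 0 < D p x.1 x.2 →
      1 / 160 * (1 - α) * Real.log K * ((H : ℝ) ^ 2 / D p x.1 x.2) ≤ pairRegret alg E K p x := by
    refine eventually_all.2 fun p => eventually_all.2 fun x => ?_
    by_cases hx : x ∉ E.subpar (ε / (768 * H)) ∧ 0 < D p x.1 x.2
    · refine (eventually_le_pairRegret hH hS hε hD0 hDH hDε hDz hDs alg halg p x
        (fun q => ?_) hx.2).mono fun K hK _ => hK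
      by_contra h
      exact hx.1 ((hsub x).2 ⟨q, not_le.1 h⟩)
    · exact Eventually.of_forall fun K h => absurd h hx
  have ev2 : ∀ᶠ K : ℕ in atTop, ∀ x, x ∈ E.subpar (ε / (768 * H)) ∧ (∀ p, 0 < D p x.1 x.2) →
      1 / 160 * (1 - α) * Real.log K * ((H : ℝ) ^ 2 / ⨅ p, D p x.1 x.2) ≤
        ∑ p, pairRegret alg E K p x := by
    refine eventually_all.2 fun x => ?_
    by_cases hx : x ∈ E.subpar (ε / (768 * H)) ∧ ∀ p, 0 < D p x.1 x.2
    · have : Nonempty (Fin M) := ((hsub x).1 hx.1).nonempty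
      exact (eventually_le_sum_pairRegret hH hS hε hD0 hDH hDε hDz hDs alg halg x hx.2).mono
        fun K hK _ => hK
    · exact Eventually.of_forall fun K h => absurd h hx
  filter_upwards [ev1, ev2] with K h1 h2
  have hreg : alg.expectedRegret E K = ∑ p, ∑ x, pairRegret alg E K p x :=
    expectedRegret_tower_eq hH hS alg _ K
  have hnn := fun p x => pairRegret_nonneg alg E K p x
  rw [hreg, gapComplexity, mul_add, Finset.mul_sum, Finset.mul_sum]
  simp_rw [Finset.mul_sum, hgap]
  have hsplit : ∑ p, ∑ x, pairRegret alg E K p x =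
      ∑ p, ∑ x with x ∉ E.subpar (ε / (768 * H)), pairRegret alg E K p x +
      ∑ x with x ∈ E.subpar (ε / (768 * H)), ∑ p, pairRegret alg E K p x := by
    rw [Finset.sum_comm (s := Finset.univ.filter fun x => x ∈ E.subpar (ε / (768 * H))),
      ← Finset.sum_add_distrib]
    refine Finset.sum_congr rfl fun p _ => ?_
    rw [add_comm]
    exact (Finset.sum_filter_add_sum_filter_not _ _ _).symm
  rw [hsplit]
  refine add_le_add (Finset.sum_le_sum fun p _ => ?_) ?_
  · refine (Finset.sum_le_sum fun x hx => h1 p x (Finset.mem_filter.1 hx).2).trans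
      (Finset.sum_le_sum_of_subset_of_nonneg (fun x hx => ?_) fun x _ _ => hnn p x)
    exact Finset.mem_filter.2 ⟨Finset.mem_univ x, (Finset.mem_filter.1 hx).2.1⟩
  · refine (Finset.sum_le_sum fun x hx => h2 x (Finset.mem_filter.1 hx).2).trans
      (Finset.sum_le_sum_of_subset_of_nonneg (fun x hx => ?_)
        fun x _ _ => Finset.sum_nonneg fun p _ => hnn p x)
    exact Finset.mem_filter.2 ⟨Finset.mem_univ x, (Finset.mem_filter.1 hx).2.1⟩

end MPERL

end

theorem theorem4 :
    ∃ c : ℝ, 0 < c ∧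
      ∀ (ε : ℝ) (S A H M : ℕ), 0 ≤ ε → 2 ≤ A → 2 ≤ H → 2 * (H - 1) < S →
      ∀ Δ : Fin (S - 2 * (H - 1)) → Fin A → Fin M → ℝ,
        (∀ s a p, 0 ≤ Δ s a p ∧ Δ s a p ≤ H / (48 * Real.sqrt M)) →
        (∀ s p, ∃ a, Δ s a p = 0) →
        (∀ s a p q, |Δ s a p - Δ s a q| ≤ ε / 4) →
        ∃ (G : MPERL.Setting S H) (E : MPERL.Environment G A M),
          E.IsDissimilar ε ∧
          (∀ s : Fin S, G.layer s = 1 ↔ (s : ℕ) < S - 2 * (H - 1)) ∧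
          (∀ h : ℕ, 2 ≤ h → h ≤ H → Fintype.card {s : Fin S // G.layer s = h} = 2) ∧
          (∀ (s : Fin (S - 2 * (H - 1))) (a : Fin A) (p : Fin M),
            E.gap p (Fin.castLE (Nat.sub_le _ _) s) a = Δ s a p) ∧
          ∀ (alg : MPERL.Algorithm S A H M) (C α : ℝ), alg.IsSublinear G ε C α →
            ∀ᶠ K : ℕ in Filter.atTop,
              c * (1 - α) * Real.log K * MPERL.gapComplexity E (ε / (768 * H)) ≤
                alg.expectedRegret E K := by
  refine ⟨1 / 160, by norm_num, fun ε S A H M hε hA hH hS Δ hΔ hΔz hΔε => ?_⟩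
  have : NeZero A := ⟨by omega⟩
  -- the gaps, extended by zero to the layers beyond the first one
  let D : Fin M → Fin S → Fin A → ℝ := fun p s a =>
    if h : (s : ℕ) < S - 2 * (H - 1) then Δ ⟨s, h⟩ a p else 0
  have hD : ∀ p (s : Fin S) a (h : (s : ℕ) < S - 2 * (H - 1)), D p s a = Δ ⟨s, h⟩ a p :=
    fun p s a h => dif_pos h
  have hDs : ∀ p (s : Fin S) a, S - 2 * (H - 1) ≤ (s : ℕ) → D p s a = 0 :=
    fun p s a h => dif_neg (not_lt.2 h)
  have hD0 : ∀ p s a, 0 ≤ D p s a := fun p s a => by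
    rcases lt_or_ge (s : ℕ) (S - 2 * (H - 1)) with h | h
    · rw [hD p s a h]; exact (hΔ _ a p).1
    · rw [hDs p s a h]
  have hDH : ∀ p s a, D p s a ≤ (H : ℝ) / 48 := fun p s a => by
    rcases lt_or_ge (s : ℕ) (S - 2 * (H - 1)) with h | h
    · rw [hD p s a h]
      have hM : (1 : ℝ) ≤ M := by exact_mod_cast p.pos
      have h1 : (1 : ℝ) ≤ Real.sqrt M := Real.one_le_sqrt.2 hM
      exact (hΔ _ a p).2.trans (div_le_div_of_nonneg_left (by positivity) (by norm_num)
        (by linarith))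
    · rw [hDs p s a h]; positivity
  have hDε : ∀ p q s a, |D p s a - D q s a| ≤ ε / 4 := fun p q s a => by
    rcases lt_or_ge (s : ℕ) (S - 2 * (H - 1)) with h | h
    · rw [hD p s a h, hD q s a h]; exact hΔε _ a p q
    · rw [hDs p s a h, hDs q s a h, sub_zero, abs_zero]; positivity
  have hDz : ∀ p s, ∃ a, D p s a = 0 := fun p s => by
    rcases lt_or_ge (s : ℕ) (S - 2 * (H - 1)) with h | h
    · obtain ⟨a, ha⟩ := hΔz ⟨s, h⟩ p
      exact ⟨a, (hD p s a h).trans ha⟩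
    · exact ⟨0, hDs p s 0 h⟩
  refine ⟨MPERL.towerSetting hH hS, MPERL.advantageTower hH hS fun p s a => -D p s a,
    MPERL.advantageTower_isDissimilar hH hS hε (fun p s a => ?_) (fun p q s a => ?_),
    MPERL.towerSetting_layer_eq_one_iff hH hS, MPERL.card_towerSetting_layer hH hS,
    fun s a p => ?_, fun alg C α halg =>
      MPERL.eventually_gapComplexity_le hH hS hε hD0 hDH hDε hDz hDs alg halg⟩
  · rw [abs_neg, abs_of_nonneg (hD0 p s a)]; exact hDH p s a
  · rw [neg_sub_neg]; exact hDε q p s a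
  · rw [MPERL.advantageTower_neg_gap hH hS hD0 hDH hDz hDs]
    exact hD p _ a s.isLt
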